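/- Let $p(n)$ denote the number of partitions of $n$ (with $p(0)=1$). Let $m\ge 5$ be a prime, let $k\ge 1$ be an integer, and put $$F(m,k;z)=\sum_{\substack{n\ge 0\\ m^k n\equiv -1 \pmod{24}}} p\left(\frac{m^k n+1}{24}\right)q^n \pmod m ,\qquad q=e^{2\pi i z}.$$ Let $\chi$ be the nontrivial quadratic character of conductor $12$ and let $\chi_m$ be the Kronecker character of $\mathbb{Q}(\sqrt m)$. Then $$F(m,k;z)\in S_{\frac{m^2-m-1}{2}}\bigl(\Gamma_0(576m),\chi\chi_m^{k-1}\bigr)_m .$$ Here $S_w(\Gamma_0(N),\psi)$, for half-integral $w\notin\mathbb{Z}$ and $4\mid N$, is the space of cusp forms of weight $w$ on $\Gamma_0(N)$ with Nebentypus $\psi$, relative to the multiplier of $\theta(z)=\sum_{n\in\mathbb{Z}}q^{n^2}$ (that is, $f(\gamma z)=\psi(d)\,(\theta(\gamma z)/\theta(z))^{2w}f(z)$ for $\gamma=\begin{pmatrix}a&b\\c&d\end{pmatrix}\in\Gamma_0(N)$), and $S_w(\Gamma_0(N),\psi)_m$ is the $\mathbb{F}_m$-vector space of the reductions mod $m$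 of the $q$-expansions of those forms in $S_w(\Gamma_0(N),\psi)$ whose coefficients are rational integers. -/

import Mathlib

open scoped UpperHalfPlane Manifold MatrixGroups

noncomputable section

namespace PartitionModM

/-- The partition function `p(n)`, with `p(0) = 1`. -/
def p (n : ℕ) : ℕ := Fintype.card (Nat.Partition n)

/-- The series `F(m, k; z) = ∑ p((m ^ k n + 1) / 24) q ^ n (mod m)`, the sum being over the
`n ≥ 0` with `m ^ k n ≡ -1 (mod 24)`, as a power series in `q` over `ℤ / m`. -/
def F (m k : ℕ) : PowerSeries (ZMod m) :=
  PowerSeries.mk fun n => if 24 ∣ m ^ k * n + 1 then (p ((m ^ k * n + 1) / 24) : ZMod m) else 0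

/-! ### The theta multiplier and cusp forms of half-integral weight -/

/-- The extended quadratic residue symbol `(c / d)` for odd `d`: it is the Jacobi symbol
`(c / |d|)`, with an additional minus sign when `c` and `d` are both negative. In particular
`(0 / ±1) = 1`. -/
def quadSymbol (c d : ℤ) : ℤ :=
  if c < 0 ∧ d < 0 then -jacobiSym c d.natAbs else jacobiSym c d.natAbs

/-- `ε_d` for odd `d`: it is `1` if `d ≡ 1 (mod 4)` and `i` if `d ≡ 3 (mod 4)`. -/
def epsilon (d : ℤ) : ℂ := if d % 4 = 1 then 1 else Complex.I

/-- The square root of `c z + d` with argument in `(-π / 2, π / 2]`, where `(c, d)` is the lower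
row of `γ`. -/
def sqrtDenom (γ : SL(2, ℤ)) (z : ℍ) : ℂ :=
  (((γ 1 0 : ℤ) : ℂ) * (z : ℂ) + ((γ 1 1 : ℤ) : ℂ)) ^ (1 / 2 : ℂ)

/-- The theta automorphy factor `j(γ, z) = (c / d) ε_d⁻¹ (c z + d) ^ (1 / 2)`, for `γ ∈ Γ₀(4)`
with lower row `(c, d)`. It equals `θ(γ z) / θ(z)` where `θ(z) = ∑ q ^ (n ^ 2)`. -/
def thetaFactor (γ : SL(2, ℤ)) (z : ℍ) : ℂ :=
  (quadSymbol (γ 1 0) (γ 1 1) : ℂ) * (epsilon (γ 1 1))⁻¹ * sqrtDenom γ z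

/-- `cuspForms κ N ψ` is the space `S_{κ / 2}(Γ₀(N), ψ)` of cusp forms of half-integral weight
`κ / 2` (`κ` odd, `4 ∣ N`) and Nebentypus `ψ`: the holomorphic functions `f` on the upper half-plane
with `f(γ z) = ψ(d) j(γ, z) ^ κ f(z)` for `γ ∈ Γ₀(N)`, which vanish at every cusp, that is,
`(c z + d) ^ (-κ / 2) f(γ z) → 0` as `Im z → ∞` for every `γ ∈ SL₂(ℤ)`. -/
def cuspForms (κ : ℤ) (N : ℕ) (ψ : DirichletCharacter ℂ N) : Submodule ℂ (ℍ → ℂ) where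
  carrier := {f | MDifferentiable 𝓘(ℂ) 𝓘(ℂ) f ∧
    (∀ γ ∈ CongruenceSubgroup.Gamma0 N, ∀ z : ℍ,
      f (γ • z) = ψ ((γ 1 1 : ℤ) : ZMod N) * thetaFactor γ z ^ κ * f z) ∧
    ∀ γ : SL(2, ℤ), UpperHalfPlane.IsZeroAtImInfty
      fun z : ℍ => sqrtDenom γ z ^ (-κ) * f (γ • z)}
  zero_mem' := by
    refine ⟨mdifferentiable_const, fun γ _ z => by simp, fun γ => ?_⟩
    simp only [Pi.zero_apply, mul_zero]
    exact (UpperHalfPlane.zeroAtImInftySubmodule ℂ).zero_mem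
  add_mem' := by
    rintro f g ⟨hf, hf', hf''⟩ ⟨hg, hg', hg''⟩
    refine ⟨hf.add hg, fun γ hγ z => ?_, fun γ => ?_⟩
    · simp only [Pi.add_apply, hf' γ hγ z, hg' γ hγ z]
      ring
    · simp only [Pi.add_apply, mul_add]
      exact (UpperHalfPlane.zeroAtImInftySubmodule ℂ).add_mem (hf'' γ) (hg'' γ)
  smul_mem' := by
    rintro a f ⟨hf, hf', hf''⟩
    refine ⟨hf.const_smul a, fun γ hγ z => ?_, fun γ => ?_⟩
    · simp only [Pi.smul_apply, smul_eq_mul, hf' γ hγ z]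
      ring
    · simp only [Pi.smul_apply, smul_eq_mul, mul_left_comm _ a]
      exact (UpperHalfPlane.zeroAtImInftySubmodule ℂ).smul_mem a (hf'' γ)

/-- `f` has the `q`-expansion `∑ a(n) q ^ n` with rational integer coefficients,
`q = exp(2 π i z)`. -/
def HasIntegralQExpansion (f : ℍ → ℂ) (a : PowerSeries ℤ) : Prop :=
  ∀ z : ℍ, HasSum
    (fun n : ℕ => ((PowerSeries.coeff n a : ℤ) : ℂ) *
      Complex.exp (2 * Real.pi * Complex.I * (n : ℂ) * (z : ℂ))) (f z)

/-- `S_{κ / 2}(Γ₀(N), ψ)_ℓ`: the space over `ℤ / ℓ` of the reductions mod `ℓ` of the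
`q`-expansions of the forms in `S_{κ / 2}(Γ₀(N), ψ)` with rational integer coefficients. -/
def cuspFormsMod (κ : ℤ) (N : ℕ) (ψ : DirichletCharacter ℂ N) (ℓ : ℕ) :
    Submodule (ZMod ℓ) (PowerSeries (ZMod ℓ)) where
  carrier := {φ | ∃ f ∈ cuspForms κ N ψ, ∃ a : PowerSeries ℤ,
    HasIntegralQExpansion f a ∧ PowerSeries.map (Int.castRingHom (ZMod ℓ)) a = φ}
  zero_mem' := ⟨0, Submodule.zero_mem _, 0, fun z => by simp, by simp⟩
  add_mem' := by
    rintro _ _ ⟨f, hf, a, ha, rfl⟩ ⟨g, hg, b, hb, rfl⟩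
    refine ⟨f + g, Submodule.add_mem _ hf hg, a + b, fun z => ?_, by simp⟩
    simpa [add_mul] using (ha z).add (hb z)
  smul_mem' := by
    rintro c _ ⟨f, hf, a, ha, rfl⟩
    obtain ⟨c, rfl⟩ := ZMod.intCast_surjective c
    refine ⟨(c : ℂ) • f, Submodule.smul_mem _ _ hf, PowerSeries.C c * a, fun z => ?_, ?_⟩
    · simpa [PowerSeries.coeff_C_mul, mul_assoc, -map_intCast, -eq_intCast] using (ha z).mul_left (c : ℂ)
    · ext n
      rw [PowerSeries.coeff_map, PowerSeries.coeff_C_mul]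
      simp

/-! ### The characters -/

/-- The nontrivial quadratic character `χ` of conductor `12`. -/
def chi12 : MulChar (ZMod 12) ℤ where
  toFun a :=
    match a with
    | 0 | 2 | 3 | 4 | 6 | 8 | 9 | 10 => 0
    | 1 | 11 => 1
    | 5 | 7 => -1
  map_one' := rfl
  map_mul' := by decide
  map_nonunit' := by decide

/-- The Kronecker character `χ_m` of `ℚ(√m)`, for an odd prime `m`, as a Dirichlet character
modulo `4 m`. The discriminant of `ℚ(√m)` is `m` if `m ≡ 1 (mod 4)`, and then
`χ_m(d) = (d / m)`; it is `4 m` if `m ≡ 3 (mod 4)`, and then `χ_m(d) = (-1 / d) (d / m)`. -/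
def kroneckerChar (m : ℕ) [Fact m.Prime] : DirichletCharacter ℂ (4 * m) :=
  let legendre : DirichletCharacter ℂ (4 * m) := DirichletCharacter.changeLevel
    (Nat.dvd_mul_left m 4) ((quadraticChar (ZMod m)).ringHomComp (Int.castRingHom ℂ))
  let chi4 : DirichletCharacter ℂ (4 * m) := DirichletCharacter.changeLevel
    (Nat.dvd_mul_right 4 m) (ZMod.χ₄.ringHomComp (Int.castRingHom ℂ))
  if m % 4 = 1 then legendre else chi4 * legendre

/-- The Nebentypus `χ χ_m ^ (k - 1)`, modulo `576 m`. -/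
def nebentypus (m k : ℕ) [Fact m.Prime] : DirichletCharacter ℂ (576 * m) :=
  DirichletCharacter.changeLevel (Dvd.intro (48 * m) (by ring) : 12 ∣ 576 * m)
      (chi12.ringHomComp (Int.castRingHom ℂ)) *
    DirichletCharacter.changeLevel (Dvd.intro 144 (by ring) : 4 * m ∣ 576 * m)
      (kroneckerChar m) ^ (k - 1)

end PartitionModM

end

noncomputable section

namespace PartitionModM

open NumberTheorySymbols ZMod

/-! ### The extended quadratic residue symbol -/

/-! Since m is prime to 6, m² = 24N + 1. Write E = ∏(1 - qⁿ) and P = 1/E for the partition series,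
so Δ^N = q^N E^(24N) = q^N E^(m²) P. Modulo m, E^(m²) is the m-th power of E evaluated at q^m, so
U_m pulls it out: U_m(Δ^N) ≡ E^m · U_m(q^N P). The Hecke operator T_m of weight 12N is congruent to
U_m modulo m, because m^(12N-1) ≡ 0. Hence (Δ^N | T_m) / E^m reduces to ∑ p(mn - N) qⁿ; replacing q
by q^24 and dividing by q^m gives exactly F(m, 1; z) (`map_quotSeries`, `map_formSeries`).

In characteristic zero this series is (Δ^N | T_m)(24z) / η(24z)^m, of weight 12N - m/2 = (m² - m -
1)/2. The numerator has level one, and η(24z) transforms on Γ₀(576) with χ times the theta factor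
(`eta_smul`), so the quotient has character χ^m = χ. Before z is scaled, its normalised absolute
value is invariant under SL₂(ℤ), so vanishing at every cusp follows from vanishing at i∞. The latter
holds because Δ^N | T_m has no terms qⁿ with 24n ≤ m (`coeff_heckeSeries_of_le`). This is
`formFun_mem_cuspForms`.

The passage from k to k + 1 is U_m applied to the form and to F(m, k). On half-integral weight U_m
preserves cusp forms of level 576m but multiplies the character by χ_m (`uFun_mem_cuspForms`):
conjugating γ by the matrices (1 v; 0 m) multiplies its lower left entry by m, which contributes the
symbol (m/d) to the theta factor, and an odd power of that symbol is the symbol itself.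

The transformation law of η is obtained by Euclid's algorithm on the lower row of γ, with quadratic
reciprocity matching the steps by S. -/

lemma chi4_natAbs_neg {d : ℤ} (hd : d < 0) : χ₄ (d.natAbs : ZMod 4) = -χ₄ (d : ZMod 4) := by
  have h : ((d.natAbs : ℕ) : ZMod 4) = -((d : ℤ) : ZMod 4) := by
    have : (d.natAbs : ℤ) = -d := by omega
    have := congrArg (Int.cast : ℤ → ZMod 4) this
    push_cast at this
    simpa using this
  rw [h]
  generalize ((d : ℤ) : ZMod 4) = x
  revert x
  decide

lemma chi4_natAbs_pos {d : ℤ} (hd : 0 < d) : χ₄ (d.natAbs : ZMod 4) = χ₄ (d : ZMod 4) := by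
  have : (d.natAbs : ℤ) = d := by omega
  have := congrArg (Int.cast : ℤ → ZMod 4) this
  push_cast at this
  rw [← this]
  simp

lemma quadSymbol_eq_of_nonneg {c : ℤ} (hc : 0 ≤ c) (d : ℤ) :
    quadSymbol c d = J(c | d.natAbs) := by
  rw [quadSymbol, if_neg (by omega)]

/-- The sign rule for two negative arguments is what replaces χ₄(|d|) by χ₄(d), which is periodic in
d itself. -/
lemma quadSymbol_eq_of_neg {c d : ℤ} (hc : c < 0) (hd : Odd d) :
    quadSymbol c d = χ₄ (d : ZMod 4) * J(-c | d.natAbs) := by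
  have hn : Odd d.natAbs := Int.natAbs_odd.mpr hd
  have h : J(c | d.natAbs) = χ₄ (d.natAbs : ZMod 4) * J(-c | d.natAbs) := by
    rw [← jacobiSym.neg _ hn, neg_neg]
  have hd0 : d ≠ 0 := by rintro rfl; simp at hd
  rcases lt_or_gt_of_ne hd0 with hd' | hd'
  · rw [quadSymbol, if_pos ⟨hc, hd'⟩, h, chi4_natAbs_neg hd']
    ring
  · rw [quadSymbol, if_neg (by omega), h, chi4_natAbs_pos hd']

/-- 4e ≡ 1 modulo 4e - 1, and 4 is a square. The number 4e - 1 serves as a positive representative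
of -1 modulo 4e on which the symbol is trivial. -/
lemma jacobiSym_four_mul_sub_one {e : ℕ} (he : 0 < e) : J(e | 4 * e - 1) = 1 := by
  have hodd : Odd (4 * e - 1) := ⟨2 * e - 1, by omega⟩
  have h : J((4 * e : ℤ) | 4 * e - 1) = J(e | 4 * e - 1) := by
    rw [jacobiSym.mul_left, jacobiSym.at_four hodd, one_mul]
  rw [← h, jacobiSym.mod_left]
  have : (4 * (e : ℤ)) % ((4 * e - 1 : ℕ) : ℤ) = 1 := by
    have h1 : ((4 * e - 1 : ℕ) : ℤ) = 4 * e - 1 := by omega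
    rw [h1, Int.emod_eq_iff (by omega)]
    exact ⟨by omega, by omega, -1, by ring⟩
  rw [this, jacobiSym.one_left]

/-- For fixed `e > 0` the symbol `(e / |d|)` depends only on `d` modulo `4 e`. -/
lemma jacobiSym_natAbs_congr {e : ℕ} (he : 0 < e) {d d' : ℤ} (hd : Odd d)
    (h : d ≡ d' [ZMOD 4 * e]) : J(e | d.natAbs) = J(e | d'.natAbs) := by
  have hd' : Odd d' := by
    have := h.dvd
    rw [Int.odd_iff] at hd ⊢
    have : (2 : ℤ) ∣ d' - d := dvd_trans ⟨2 * e, by ring⟩ this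
    omega
  have hd0 : d ≠ 0 := by rintro rfl; simp at hd
  have hd0' : d' ≠ 0 := by rintro rfl; simp at hd'
  have same : ∀ {a b : ℕ}, Odd a → Odd b → (a : ℤ) ≡ b [ZMOD 4 * e] → J(e | a) = J(e | b) := by
    intro a b ha hb hab
    rw [jacobiSym.mod_right' e ha, jacobiSym.mod_right' e hb]
    have : a ≡ b [MOD 4 * e] := by
      rw [← Int.natCast_modEq_iff]
      exact_mod_cast hab
    rw [show a % (4 * e) = b % (4 * e) from this]
  -- Multiplying b by 4e - 1 moves it to the class of -b modulo 4e without changing the symbol; this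
  -- handles d and d' of opposite signs.
  have opp : ∀ {a b : ℕ}, Odd a → Odd b → (a : ℤ) ≡ -b [ZMOD 4 * e] → J(e | a) = J(e | b) := by
    intro a b ha hb hab
    have hodd : Odd (4 * e - 1) := ⟨2 * e - 1, by omega⟩
    rw [same ha (hb.mul hodd), jacobiSym.mul_right' _ hb.pos.ne' hodd.pos.ne',
      jacobiSym_four_mul_sub_one he, mul_one]
    refine hab.trans ?_
    rw [Int.modEq_iff_dvd]
    refine ⟨b, ?_⟩
    have h1 : ((4 * e - 1 : ℕ) : ℤ) = 4 * e - 1 := by omega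
    push_cast [h1]
    ring
  have ha := Int.natAbs_odd.mpr hd
  have hb := Int.natAbs_odd.mpr hd'
  rcases lt_or_gt_of_ne hd0 with h0 | h0 <;> rcases lt_or_gt_of_ne hd0' with h0' | h0'
  · refine same ha hb ?_
    rw [Int.ofNat_natAbs_of_nonpos h0.le, Int.ofNat_natAbs_of_nonpos h0'.le]
    exact h.neg
  · refine opp ha hb ?_
    rw [Int.ofNat_natAbs_of_nonpos h0.le, Int.natAbs_of_nonneg h0'.le]
    exact h.neg
  · refine opp ha hb ?_
    rw [Int.ofNat_natAbs_of_nonpos h0'.le, Int.natAbs_of_nonneg h0.le, neg_neg]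
    exact h
  · refine same ha hb ?_
    rw [Int.natAbs_of_nonneg h0'.le, Int.natAbs_of_nonneg h0.le]
    exact h

lemma quadSymbol_congr {e d d' : ℤ} (he : e ≠ 0) (hd : Odd d) (h : d ≡ d' [ZMOD 4 * e]) :
    quadSymbol e d = quadSymbol e d' := by
  have hd' : Odd d' := by
    have := h.dvd
    rw [Int.odd_iff] at hd ⊢
    have : (2 : ℤ) ∣ d' - d := dvd_trans ⟨2 * e, by ring⟩ this
    omega
  rcases lt_or_gt_of_ne he with h0 | h0
  · obtain ⟨n, hn⟩ := Int.eq_ofNat_of_zero_le (show 0 ≤ -e by omega)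
    have hn0 : 0 < n := by omega
    have h4 : ((d : ℤ) : ZMod 4) = d' := by
      rw [ZMod.intCast_eq_intCast_iff]
      exact h.of_dvd ⟨e, by push_cast; ring⟩
    rw [quadSymbol_eq_of_neg h0 hd, quadSymbol_eq_of_neg h0 hd', hn, h4,
      jacobiSym_natAbs_congr hn0 hd]
    exact h.of_dvd ⟨-1, by rw [← hn]; ring⟩
  · obtain ⟨n, rfl⟩ := Int.eq_ofNat_of_zero_le h0.le
    have hn0 : 0 < n := by omega
    rw [quadSymbol_eq_of_nonneg h0.le, quadSymbol_eq_of_nonneg h0.le,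
      jacobiSym_natAbs_congr hn0 hd h]

lemma quadSymbol_mul_of_pos {n : ℤ} (hn : 0 < n) (c d : ℤ) :
    quadSymbol (n * c) d = J(n | d.natAbs) * quadSymbol c d := by
  have h : n * c < 0 ↔ c < 0 := by
    constructor
    · intro h; by_contra h'; nlinarith
    · intro h; nlinarith
  simp only [quadSymbol, h, jacobiSym.mul_left]
  split_ifs <;> ring

lemma jacobiSym_sq_eq_one {a d : ℤ} (h : IsCoprime a d) : J(a ^ 2 | d.natAbs) = 1 := by
  apply jacobiSym.sq_one'
  rw [Int.isCoprime_iff_gcd_eq_one] at h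
  rwa [Int.gcd, Int.natAbs_natCast, ← Int.gcd]

/-- The source of the twist by χ_m. With c = 576me one has mc = (24m)²e and c = 24²·me; the squares
drop out, and d - cv ≡ d modulo 4e, so both sides reduce to (e/d) because (m/d)² = 1. -/
lemma quadSymbol_natCast_mul_sub {m : ℕ} (hm : 0 < m) {c d : ℤ} (hc : (576 * m : ℤ) ∣ c)
    (hcd : IsCoprime c d) (v : ℤ) :
    quadSymbol (m * c) (d - c * v) = J(m | d.natAbs) * quadSymbol c d := by
  rcases eq_or_ne c 0 with rfl | hc0
  · simp only [mul_zero, zero_mul, sub_zero]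
    have hd : d.natAbs = 1 := by
      rw [isCoprime_zero_left] at hcd
      exact Int.isUnit_iff_natAbs_eq.mp hcd
    rw [hd, jacobiSym.one_right, one_mul]
  obtain ⟨e, he⟩ := hc
  have he0 : e ≠ 0 := by rintro rfl; simp at he; exact hc0 he
  have hcd' : IsCoprime c (d - c * v) := by
    have := hcd.add_mul_left_right (-v)
    rwa [mul_neg, ← sub_eq_add_neg] at this
  have h24 : IsCoprime (24 : ℤ) d := hcd.of_isCoprime_of_dvd_left ⟨24 * m * e, by rw [he]; ring⟩
  have hd : Odd d := by
    have h2 : IsCoprime (2 : ℤ) d := h24.of_isCoprime_of_dvd_left ⟨12, by norm_num⟩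
    rcases Int.even_or_odd d with h | h
    · obtain ⟨x, y, hxy⟩ := h2
      obtain ⟨t, ht⟩ := h
      have : (2 : ℤ) * (x + y * t) = 1 := by rw [← hxy, ht]; ring
      omega
    · exact h
  have hd' : d ≡ d - c * v [ZMOD 4 * e] := by
    rw [Int.modEq_iff_dvd]
    exact ⟨-144 * m * v, by rw [he]; ring⟩
  have h24m : IsCoprime (24 * m : ℤ) (d - c * v) :=
    hcd'.of_isCoprime_of_dvd_left ⟨24 * e, by rw [he]; ring⟩
  have hm' : (0 : ℤ) < m := by exact_mod_cast hm
  rw [show (m : ℤ) * c = (24 * m) ^ 2 * e by rw [he]; ring, quadSymbol_mul_of_pos (by positivity),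
    jacobiSym_sq_eq_one h24m, ← quadSymbol_congr he0 hd hd', one_mul,
    show c = 24 ^ 2 * (m * e) by rw [he]; ring, quadSymbol_mul_of_pos (by positivity),
    jacobiSym_sq_eq_one h24, quadSymbol_mul_of_pos hm', one_mul, ← mul_assoc, ← pow_two,
    ← jacobiSym.pow_left, jacobiSym_sq_eq_one, one_mul]
  exact hcd.of_isCoprime_of_dvd_left ⟨576 * e, by rw [he]; ring⟩

/-! ### The characters -/

lemma jacobiSym_natCast_natAbs_of_mod_four_eq_one {m : ℕ} (hm : m % 4 = 1) {d : ℤ} (hd : Odd d) :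
    J(m | d.natAbs) = J(d | m) := by
  have hn : Odd d.natAbs := Int.natAbs_odd.mpr hd
  have hmo : Odd m := Nat.odd_iff.mpr (by omega)
  rw [jacobiSym.quadratic_reciprocity_one_mod_four hm hn]
  rcases le_total 0 d with h | h
  · rw [Int.natAbs_of_nonneg h]
  · rw [Int.ofNat_natAbs_of_nonpos h, jacobiSym.neg _ hmo, ZMod.χ₄_nat_one_mod_four hm, one_mul]

lemma jacobiSym_natCast_natAbs_of_mod_four_eq_three {m : ℕ} (hm : m % 4 = 3) {d : ℤ}
    (hd : Odd d) : J(m | d.natAbs) = χ₄ (d : ZMod 4) * J(d | m) := by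
  have hn : Odd d.natAbs := Int.natAbs_odd.mpr hd
  have hmo : Odd m := Nat.odd_iff.mpr (by omega)
  have key : J(m | d.natAbs) = χ₄ (d.natAbs : ZMod 4) * J(d.natAbs | m) := by
    rcases Nat.odd_mod_four_iff.mp (Nat.odd_iff.mp hn) with h | h
    · rw [ZMod.χ₄_nat_one_mod_four h, one_mul,
        jacobiSym.quadratic_reciprocity_one_mod_four h hmo]
    · rw [ZMod.χ₄_nat_three_mod_four h, jacobiSym.quadratic_reciprocity_three_mod_four hm h]
      ring
  have hd0 : d ≠ 0 := by rintro rfl; simp at hd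
  rcases lt_or_gt_of_ne hd0 with h | h
  · rw [key, chi4_natAbs_neg h, Int.ofNat_natAbs_of_nonpos h.le, jacobiSym.neg _ hmo,
      ZMod.χ₄_nat_three_mod_four hm]
    ring
  · rw [key, chi4_natAbs_pos h, Int.natAbs_of_nonneg h.le]

lemma changeLevel_intCast {n N : ℕ} (hnN : n ∣ N) (ψ : DirichletCharacter ℂ n) {d : ℤ}
    (h : IsCoprime (N : ℤ) d) :
    DirichletCharacter.changeLevel hnN ψ ((d : ℤ) : ZMod N) = ψ ((d : ℤ) : ZMod n) :=
  DirichletCharacter.changeLevel_eq_cast_of_dvd' ψ hnN h.symm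

/-- By quadratic reciprocity both shapes of the discriminant give the single symbol (m/|d|), the
factor that U_m produces. -/
lemma kroneckerChar_intCast {m : ℕ} [Fact m.Prime] (hm : m ≠ 2) {d : ℤ}
    (h : IsCoprime ((4 * m : ℕ) : ℤ) d) :
    kroneckerChar m ((d : ℤ) : ZMod (4 * m)) = (J(m | d.natAbs) : ℂ) := by
  have hd : Odd d := by
    rcases Int.even_or_odd d with h' | h'
    · obtain ⟨x, y, hxy⟩ := h
      obtain ⟨t, ht⟩ := h'
      push_cast at hxy
      have h2 : (2 : ℤ) * (x * (2 * m) + y * t) = 1 := by rw [← hxy, ht]; ring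
      omega
    · exact h'
  have hodd := Nat.Prime.eq_two_or_odd (Fact.out : m.Prime)
  have hleg : quadraticChar (ZMod m) ((d : ℤ) : ZMod m) = J(d | m) := by
    rw [← jacobiSym.legendreSym.to_jacobiSym, legendreSym]
  unfold kroneckerChar
  by_cases hm1 : m % 4 = 1
  · simp only [hm1, if_true]
    rw [changeLevel_intCast _ _ h, MulChar.ringHomComp_apply, hleg,
      jacobiSym_natCast_natAbs_of_mod_four_eq_one hm1 hd]
    simp
  · have hm3 : m % 4 = 3 := by omega
    simp only [hm1, if_false]
    rw [MulChar.mul_apply, changeLevel_intCast _ _ h, changeLevel_intCast _ _ h,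
      MulChar.ringHomComp_apply, MulChar.ringHomComp_apply, hleg,
      jacobiSym_natCast_natAbs_of_mod_four_eq_three hm3 hd]
    simp

lemma nebentypus_one {m : ℕ} [Fact m.Prime] {d : ℤ} (h : IsCoprime ((576 * m : ℕ) : ℤ) d) :
    nebentypus m 1 ((d : ℤ) : ZMod (576 * m)) = (chi12 ((d : ℤ) : ZMod 12) : ℂ) := by
  rw [nebentypus, Nat.sub_self, pow_zero, mul_one, changeLevel_intCast _ _ h,
    MulChar.ringHomComp_apply]
  simp

lemma nebentypus_succ {m : ℕ} [Fact m.Prime] (hm : m ≠ 2) {k : ℕ} (hk : 1 ≤ k) {d : ℤ}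
    (h : IsCoprime ((576 * m : ℕ) : ℤ) d) :
    nebentypus m (k + 1) ((d : ℤ) : ZMod (576 * m)) =
      nebentypus m k ((d : ℤ) : ZMod (576 * m)) * (J(m | d.natAbs) : ℂ) := by
  have h4 : IsCoprime ((4 * m : ℕ) : ℤ) d :=
    h.of_isCoprime_of_dvd_left ⟨144, by push_cast; ring⟩
  obtain ⟨j, rfl⟩ := Nat.exists_eq_add_of_le' hk
  rw [nebentypus, nebentypus, Nat.add_sub_cancel, Nat.add_sub_cancel, pow_succ, ← mul_assoc,
    MulChar.mul_apply _ (DirichletCharacter.changeLevel _ (kroneckerChar m)),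
    changeLevel_intCast _ (kroneckerChar m) h, kroneckerChar_intCast hm h4]

/-- Reciprocity at 3, then a check of the four units modulo 12. This form shows that χ is even and
lets it be read off from the symbol (24/d). -/
lemma chi12_intCast_eq {d : ℤ} (h : IsCoprime (6 : ℤ) d) :
    chi12 ((d : ℤ) : ZMod 12) = J(3 | d.natAbs) := by
  have hd : Odd d := by
    obtain ⟨x, y, hxy⟩ := h
    rcases Int.even_or_odd d with ⟨t, ht⟩ | h'
    · have h2 : (2 : ℤ) * (x * 3 + y * t) = 1 := by rw [← hxy, ht]; ring
      omega
    · exact h'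
  have h3 : d % 3 ≠ 0 := by
    intro h3
    obtain ⟨t, rfl⟩ := Int.dvd_of_emod_eq_zero h3
    obtain ⟨x, y, hxy⟩ := h
    have h2 : (3 : ℤ) * (x * 2 + y * t) = 1 := by rw [← hxy]; ring
    omega
  rw [show (3 : ℤ) = ((3 : ℕ) : ℤ) by norm_num,
    jacobiSym_natCast_natAbs_of_mod_four_eq_three (by norm_num) hd, jacobiSym.mod_left]
  rw [Int.odd_iff] at hd
  have hr : d % 12 = 1 ∨ d % 12 = 5 ∨ d % 12 = 7 ∨ d % 12 = 11 := by omega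
  have h12 : ((d : ℤ) : ZMod 12) = ((d % 12 : ℤ) : ZMod 12) := by
    rw [ZMod.intCast_eq_intCast_iff]; exact (Int.mod_modEq _ _).symm
  have h4 : ((d : ℤ) : ZMod 4) = ((d % 12 : ℤ) : ZMod 4) := by
    rw [ZMod.intCast_eq_intCast_iff]
    exact ((Int.mod_modEq d 12).of_dvd (by norm_num)).symm
  have h3' : d % ((3 : ℕ) : ℤ) = (d % 12) % 3 := by norm_num
  rw [h12, h4, h3']
  rcases hr with h | h | h | h <;> rw [h]
  · have : J(1 | 3) = 1 := by norm_num
    rw [show (1 : ℤ) % 3 = 1 by norm_num, this]; decide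
  · have : J(2 | 3) = -1 := by norm_num
    rw [show (5 : ℤ) % 3 = 2 by norm_num, this]; decide
  · have : J(1 | 3) = 1 := by norm_num
    rw [show (7 : ℤ) % 3 = 1 by norm_num, this]; decide
  · have : J(2 | 3) = -1 := by norm_num
    rw [show (11 : ℤ) % 3 = 2 by norm_num, this]; decide

end PartitionModM

namespace PartitionModM

open NumberTheorySymbols ZMod ModularGroup

/-! ### The multiplier system of the eta function -/

/-- The root of unity `exp(2 π i n / 24)`. -/
def e24 (n : ℤ) : ℂ := Complex.exp (2 * Real.pi * Complex.I * n / 24)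

lemma e24_add (a b : ℤ) : e24 (a + b) = e24 a * e24 b := by
  rw [e24, e24, e24, ← Complex.exp_add]
  congr 1
  push_cast
  ring

lemma e24_zero : e24 0 = 1 := by simp [e24]

lemma e24_mul_neg (a : ℤ) : e24 a * e24 (-a) = 1 := by
  rw [← e24_add, add_neg_cancel, e24_zero]

lemma e24_period (t : ℤ) : e24 (24 * t) = 1 := by
  rw [e24, Complex.exp_eq_one_iff]
  refine ⟨t, ?_⟩
  push_cast
  ring

lemma e24_congr {a b : ℤ} (h : a ≡ b [ZMOD 24]) : e24 a = e24 b := by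
  obtain ⟨t, ht⟩ := h.dvd
  rw [show b = a + 24 * t by omega, e24_add, e24_period, mul_one]

lemma e24_twelve : e24 12 = -1 := by
  rw [e24, ← Complex.exp_pi_mul_I]
  congr 1
  push_cast
  ring

lemma e24_six : e24 6 = Complex.I := by
  have h : (2 * Real.pi * Complex.I * (6 : ℤ) / 24 : ℂ) = Real.pi / 2 * Complex.I := by
    push_cast
    ring
  rw [e24, h, Complex.exp_pi_div_two_mul_I]

lemma e24_twelve_mul (t : ℤ) : e24 (12 * t) = if Even t then 1 else -1 := by
  split_ifs with h
  · obtain ⟨s, rfl⟩ := h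
    rw [show 12 * (s + s) = 24 * s by ring, e24_period]
  · obtain ⟨s, rfl⟩ := Int.not_even_iff_odd.mp h
    rw [show 12 * (2 * s + 1) = 12 + 24 * s by ring, e24_add, e24_period, e24_twelve, mul_one]

/-! ### Principal square roots on the upper half-plane. -/

lemma cpow_half_sq (w : ℂ) : (w ^ (1 / 2 : ℂ)) ^ 2 = w := by
  rw [← Complex.cpow_nat_mul]
  norm_num

lemma cpow_half_re_im_pos {w : ℂ} (hw : 0 < w.im) :
    0 < (w ^ (1 / 2 : ℂ)).re ∧ 0 < (w ^ (1 / 2 : ℂ)).im := by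
  have h0 : w ≠ 0 := by rintro rfl; simp at hw
  have h1 : 0 < w.arg := by
    refine lt_of_le_of_ne (Complex.arg_nonneg_iff.mpr hw.le) fun h => ?_
    have := Complex.arg_eq_zero_iff.mp h.symm
    linarith [this.2]
  have h2 := Complex.arg_le_pi w
  have h3 : w.arg < Real.pi := by
    refine lt_of_le_of_ne h2 fun h => ?_
    have := Complex.arg_eq_pi_iff.mp h
    linarith [this.2]
  have him : (Complex.log w * (1 / 2)).im = w.arg / 2 := by
    rw [show (1 / 2 : ℂ) = ((1 / 2 : ℝ) : ℂ) by norm_num, Complex.im_mul_ofReal, Complex.log_im]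
    ring
  rw [Complex.cpow_def_of_ne_zero h0, Complex.exp_re, Complex.exp_im, him]
  exact ⟨mul_pos (Real.exp_pos _) (Real.cos_pos_of_mem_Ioo ⟨by linarith, by linarith⟩),
    mul_pos (Real.exp_pos _) (Real.sin_pos_of_pos_of_lt_pi (by linarith) (by linarith))⟩

/-- The two sides agree up to sign. Square roots of points of the upper half-plane lie in the open
first quadrant, and a product of two such numbers has positive imaginary part, which excludes the
minus sign. -/
lemma cpow_half_mul {a b : ℂ} (ha : 0 < a.im) (hb : 0 < b.im) (hab : 0 < (a * b).im) :
    (a * b) ^ (1 / 2 : ℂ) = a ^ (1 / 2 : ℂ) * b ^ (1 / 2 : ℂ) := by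
  have h : ((a * b) ^ (1 / 2 : ℂ)) ^ 2 = (a ^ (1 / 2 : ℂ) * b ^ (1 / 2 : ℂ)) ^ 2 := by
    rw [mul_pow, cpow_half_sq, cpow_half_sq, cpow_half_sq]
  rcases sq_eq_sq_iff_eq_or_eq_neg.mp h with h | h
  · exact h
  · have h1 := cpow_half_re_im_pos ha
    have h2 := cpow_half_re_im_pos hb
    have h3 := (cpow_half_re_im_pos hab).2
    rw [h, Complex.neg_im, Complex.mul_im] at h3
    nlinarith [mul_pos h1.1 h2.2, mul_pos h1.2 h2.1]

/-! ### The behaviour of η under T and S. -/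

lemma eta_vadd (z : ℂ) (n : ℤ) : ModularForm.eta (z + n) = e24 n * ModularForm.eta z := by
  have h : ∀ k : ℕ, ModularForm.eta_q k (z + n) = ModularForm.eta_q k z := by
    intro k
    have : Function.Periodic.qParam 1 (z + n) = Function.Periodic.qParam 1 z := by
      rw [Function.Periodic.qParam, Function.Periodic.qParam, Complex.exp_eq_exp_iff_exists_int]
      exact ⟨n, by push_cast; ring⟩
    rw [ModularForm.eta_q, ModularForm.eta_q, this]
  rw [ModularForm.eta, ModularForm.eta]
  simp_rw [h]
  rw [← mul_assoc]
  congr 1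
  rw [Function.Periodic.qParam, Function.Periodic.qParam, e24, ← Complex.exp_add]
  congr 1
  push_cast
  ring

lemma eta_neg_inv (z : ℍ) :
    ModularForm.eta (-(z : ℂ)⁻¹) = e24 (-3) * (z : ℂ) ^ (1 / 2 : ℂ) * ModularForm.eta z := by
  have h := ModularForm.eta_comp_eq_csqrt_I_inv z.2
  have hI : (Complex.I ^ (2⁻¹ : ℂ))⁻¹ = e24 (-3) := by
    rw [Complex.cpow_def_of_ne_zero Complex.I_ne_zero, Complex.log_I,
      ← Complex.exp_neg, e24]
    congr 1
    push_cast
    ring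
  simp only [Function.comp_apply, Pi.smul_apply, Pi.mul_apply, smul_eq_mul, Complex.sqrt] at h
  rw [neg_div, one_div, hI] at h
  rw [h, one_div]
  ring

/-- `w` is the value at `γ` of the multiplier of the eta function. -/
def IsEtaMultiplier (γ : SL(2, ℤ)) (w : ℂ) : Prop :=
  ∀ z : ℍ, ModularForm.eta (γ • z : ℍ) = w * sqrtDenom γ z * ModularForm.eta z

lemma mul_T_zpow_apply (γ : SL(2, ℤ)) (n : ℤ) :
    (γ * T ^ n) 0 0 = γ 0 0 ∧ (γ * T ^ n) 0 1 = γ 0 1 + n * γ 0 0 ∧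
      (γ * T ^ n) 1 0 = γ 1 0 ∧ (γ * T ^ n) 1 1 = γ 1 1 + n * γ 1 0 := by
  simp only [Matrix.SpecialLinearGroup.coe_mul, coe_T_zpow, Matrix.mul_apply, Fin.sum_univ_two]
  simp
  constructor <;> ring

lemma mul_S_apply (γ : SL(2, ℤ)) :
    (γ * S) 0 0 = γ 0 1 ∧ (γ * S) 0 1 = -γ 0 0 ∧ (γ * S) 1 0 = γ 1 1 ∧ (γ * S) 1 1 = -γ 1 0 := by
  simp only [Matrix.SpecialLinearGroup.coe_mul, coe_S, Matrix.mul_apply, Fin.sum_univ_two]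
  simp

lemma mul_S_inv_apply (γ : SL(2, ℤ)) :
    (γ * S⁻¹) 0 0 = -γ 0 1 ∧ (γ * S⁻¹) 0 1 = γ 0 0 ∧ (γ * S⁻¹) 1 0 = -γ 1 1 ∧
      (γ * S⁻¹) 1 1 = γ 1 0 := by
  obtain ⟨h1, h2, h3, h4⟩ := mul_S_apply (γ * S⁻¹)
  rw [inv_mul_cancel_right] at h1 h2 h3 h4
  refine ⟨?_, h1.symm, ?_, h3.symm⟩ <;> omega

lemma det_eq (γ : SL(2, ℤ)) : γ 0 0 * γ 1 1 - γ 0 1 * γ 1 0 = 1 := by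
  have := γ.det_coe
  rwa [Matrix.det_fin_two] at this

lemma coe_T_zpow_smul' (n : ℤ) (z : ℍ) : ((T ^ n • z : ℍ) : ℂ) = z + n := by
  rw [UpperHalfPlane.modular_T_zpow_smul, UpperHalfPlane.coe_vadd]
  push_cast
  ring

lemma coe_S_smul' (z : ℍ) : ((S • z : ℍ) : ℂ) = -(z : ℂ)⁻¹ := by
  rw [UpperHalfPlane.modular_S_smul, ← inv_neg]

lemma IsEtaMultiplier.mul_T_zpow {γ : SL(2, ℤ)} {w : ℂ} (h : IsEtaMultiplier γ w) (n : ℤ) :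
    IsEtaMultiplier (γ * T ^ n) (w * e24 n) := by
  intro z
  have hs : sqrtDenom (γ * T ^ n) z = sqrtDenom γ (T ^ n • z) := by
    obtain ⟨-, -, h3, h4⟩ := mul_T_zpow_apply γ n
    rw [sqrtDenom, sqrtDenom, h3, h4, coe_T_zpow_smul']
    congr 1
    push_cast
    ring
  rw [mul_smul, h, hs, coe_T_zpow_smul', eta_vadd]
  ring

/-- Positivity of c and d puts c·Sz + d, z and their product dz - c all in the upper half-plane,
where the principal root is multiplicative. -/
lemma sqrtDenom_mul_S {γ : SL(2, ℤ)} (hc : 0 < γ 1 0) (hd : 0 < γ 1 1) (z : ℍ) :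
    sqrtDenom (γ * S) z = sqrtDenom γ (S • z) * (z : ℂ) ^ (1 / 2 : ℂ) := by
  obtain ⟨-, -, h3, h4⟩ := mul_S_apply γ
  have hz : (z : ℂ) ≠ 0 := z.ne_zero
  have him : ∀ (c d : ℤ) (w : ℍ), 0 < c → 0 < (((c : ℤ) : ℂ) * (w : ℂ) + ((d : ℤ) : ℂ)).im := by
    intro c d w hc
    have : (0 : ℝ) < c := by exact_mod_cast hc
    simpa using mul_pos this w.2
  have hmul : (((γ 1 0 : ℤ) : ℂ) * ((S • z : ℍ) : ℂ) + ((γ 1 1 : ℤ) : ℂ)) * z =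
      ((γ 1 1 : ℤ) : ℂ) * (z : ℂ) + ((-γ 1 0 : ℤ) : ℂ) := by
    rw [coe_S_smul']
    push_cast
    field_simp
    ring
  rw [sqrtDenom, sqrtDenom, h3, h4, ← hmul]
  refine cpow_half_mul (him _ _ _ hc) z.2 ?_
  rw [hmul]
  exact him _ _ _ hd

lemma IsEtaMultiplier.mul_S {γ : SL(2, ℤ)} {w : ℂ} (hc : 0 < γ 1 0) (hd : 0 < γ 1 1)
    (h : IsEtaMultiplier γ w) : IsEtaMultiplier (γ * S) (w * e24 (-3)) := by
  intro z
  rw [mul_smul, h, sqrtDenom_mul_S hc hd, coe_S_smul', eta_neg_inv]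
  ring

lemma IsEtaMultiplier.of_mul_S {γ : SL(2, ℤ)} {w : ℂ} (hc : 0 < γ 1 0) (hd : 0 < γ 1 1)
    (h : IsEtaMultiplier (γ * S) w) : IsEtaMultiplier γ (w * e24 3) := by
  intro z
  obtain ⟨y, rfl⟩ : ∃ y : ℍ, z = S • y := ⟨S⁻¹ • z, by rw [smul_inv_smul]⟩
  have h1 := h y
  rw [mul_smul, sqrtDenom_mul_S hc hd] at h1
  rw [h1, coe_S_smul' y, eta_neg_inv]
  linear_combination (-w * sqrtDenom γ (S • y) * (y : ℂ) ^ (1 / 2 : ℂ) * ModularForm.eta y) *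
    e24_mul_neg 3

/-- The value of the eta multiplier at `γ` with odd positive lower left entry. -/
def etaMultiplier (γ : SL(2, ℤ)) : ℂ :=
  J(γ 1 1 | (γ 1 0).natAbs) *
    e24 ((γ 0 0 + γ 1 1) * γ 1 0 - γ 0 1 * γ 1 1 * ((γ 1 0) ^ 2 - 1) - 3 * γ 1 0)

lemma dvd_cube_sub {c : ℤ} (hc : Odd c) : (24 : ℤ) ∣ c * (c ^ 2 - 1) := by
  obtain ⟨t, rfl⟩ := hc
  have h1 : (2 : ℤ) ∣ t * (t + 1) := (Int.even_mul_succ_self t).two_dvd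
  have h3 : (3 : ℤ) ∣ t * (t + 1) * (2 * t + 1) := by
    have : t % 3 = 0 ∨ t % 3 = 1 ∨ t % 3 = 2 := by omega
    rcases this with h | h | h
    · exact Dvd.dvd.mul_right (Dvd.dvd.mul_right (Int.dvd_of_emod_eq_zero h) _) _
    · exact Dvd.dvd.mul_left (by omega) _
    · exact Dvd.dvd.mul_right (Dvd.dvd.mul_left (by omega) _) _
  have h6 : (6 : ℤ) ∣ t * (t + 1) * (2 * t + 1) := by
    have h2 : (2 : ℤ) ∣ t * (t + 1) * (2 * t + 1) := h1.mul_right _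
    omega
  obtain ⟨s, hs⟩ := h6
  exact ⟨s, by linear_combination 4 * hs⟩

lemma etaMultiplier_mul_T_zpow {γ : SL(2, ℤ)} (hc : Odd (γ 1 0)) (n : ℤ) :
    etaMultiplier (γ * T ^ n) = etaMultiplier γ * e24 n := by
  obtain ⟨h1, h2, h3, h4⟩ := mul_T_zpow_apply γ n
  rw [etaMultiplier, etaMultiplier, h1, h2, h3, h4, mul_assoc (_ : ℂ), ← e24_add]
  congr 1
  · congr 1
    apply jacobiSym.mod_left'
    rcases Int.natAbs_eq (γ 1 0) with h | h
    · rw [← h, Int.add_mul_emod_self_right]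
    · rw [show ((γ 1 0).natAbs : ℤ) = -γ 1 0 by omega, Int.emod_neg, Int.emod_neg,
        Int.add_mul_emod_self_right]
  · apply e24_congr
    have hdet := det_eq γ
    obtain ⟨s, hs⟩ := dvd_cube_sub hc
    set a := γ 0 0
    set b := γ 0 1
    set c := γ 1 0
    set d := γ 1 1
    rw [Int.modEq_iff_dvd]
    -- Using ad - bc = 1, the shift changes the exponent by n - n(2b + na)·c(c² - 1), and c(c² - 1)
    -- = 24s for odd c.
    refine ⟨n * (2 * b + n * a) * s, ?_⟩
    linear_combination (n * (2 * b + n * a)) * hs + n * (c ^ 2 - 1) * hdet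

/-- (-1/d) contributes (d-1)/2 to the exponent of -1 and reciprocity contributes (c-1)(d-1)/4; the
sum is (c+1)(d-1)/4 = t. -/
lemma jacobiSym_neg_swap {c d : ℤ} (hc : 0 < c) (hd : 0 < d) (hc' : Odd c) (hd' : Odd d)
    {t : ℤ} (ht : (c + 1) * (d - 1) = 4 * t) :
    J(-c | d.natAbs) = (if Even t then 1 else -1) * J(d | c.natAbs) := by
  lift c to ℕ using hc.le
  lift d to ℕ using hd.le
  simp only [Int.natAbs_natCast]
  have hcn : Odd c := by exact_mod_cast hc'
  have hdn : Odd d := by exact_mod_cast hd'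
  rw [jacobiSym.neg _ hdn]
  rcases Nat.odd_mod_four_iff.mp (Nat.odd_iff.mp hdn) with h | h
  · rw [ZMod.χ₄_nat_one_mod_four h, jacobiSym.quadratic_reciprocity_one_mod_four' hcn h,
      if_pos, one_mul]
    obtain ⟨k, hk⟩ := hcn
    obtain ⟨j, hj⟩ : ∃ j, d = 4 * j + 1 := ⟨d / 4, by omega⟩
    refine ⟨(k + 1) * j, ?_⟩
    subst hk hj
    push_cast at ht
    linarith
  · rw [ZMod.χ₄_nat_three_mod_four h]
    obtain ⟨j, hj⟩ : ∃ j, d = 4 * j + 3 := ⟨d / 4, by omega⟩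
    rcases Nat.odd_mod_four_iff.mp (Nat.odd_iff.mp hcn) with h1 | h1
    · rw [jacobiSym.quadratic_reciprocity_one_mod_four h1 hdn, if_neg]
      obtain ⟨k, hk⟩ : ∃ k, c = 4 * k + 1 := ⟨c / 4, by omega⟩
      rw [Int.not_even_iff_odd]
      refine ⟨2 * k * j + k + j, ?_⟩
      subst hk hj
      push_cast at ht
      linarith
    · rw [jacobiSym.quadratic_reciprocity_three_mod_four h1 h, if_pos]
      · ring
      obtain ⟨k, hk⟩ : ∃ k, c = 4 * k + 3 := ⟨c / 4, by omega⟩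
      refine ⟨(k + 1) * (2 * j + 1), ?_⟩
      subst hk hj
      push_cast at ht
      linarith

lemma etaMultiplier_mul_S {γ : SL(2, ℤ)} (hc : 0 < γ 1 0) (hd : 0 < γ 1 1) (hc' : Odd (γ 1 0))
    (hd' : Odd (γ 1 1)) : etaMultiplier (γ * S) = etaMultiplier γ * e24 (-3) := by
  obtain ⟨h1, h2, h3, h4⟩ := mul_S_apply γ
  obtain ⟨t, ht⟩ : ∃ t, (γ 1 0 + 1) * (γ 1 1 - 1) = 4 * t := by
    obtain ⟨k, hk⟩ := hc'
    obtain ⟨j, hj⟩ := hd'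
    exact ⟨(k + 1) * j, by rw [hk, hj]; ring⟩
  rw [etaMultiplier, etaMultiplier, h1, h2, h3, h4, jacobiSym_neg_swap hc hd hc' hd' ht,
    mul_assoc (_ : ℂ), ← e24_add]
  have hsign : (((if Even t then 1 else -1 : ℤ)) : ℂ) = e24 (12 * t) := by
    rw [e24_twelve_mul]; split_ifs <;> simp
  push_cast [hsign]
  rw [mul_comm (e24 _), mul_assoc (_ : ℂ), ← e24_add]
  congr 1
  apply e24_congr
  have hdet := det_eq γ
  rw [Int.modEq_iff_dvd]
  -- Once the reciprocity sign is written as `e24 (12 * t)`, the two exponents are equal as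
  -- integers.
  refine ⟨0, ?_⟩
  linear_combination (γ 1 0 * γ 1 1) * hdet + 3 * ht

/-- As c is odd, the residue of d modulo c and that residue minus c have opposite parities, so one
of them is odd. Oddness keeps the Euclidean descent inside the range of the formula for odd lower
left entry. -/
lemma exists_odd_shift {c : ℤ} (hc : 1 < c) (hc' : Odd c) {d : ℤ} (h : IsCoprime c d) :
    ∃ n, Odd (d + n * c) ∧ (0 < d + n * c ∧ d + n * c < c ∨ d + n * c < 0 ∧ -c < d + n * c) := by
  have h1 := Int.emod_nonneg d (show c ≠ 0 by omega)
  have h2 := Int.emod_lt_of_pos d (show 0 < c by omega)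
  have h3 : d % c = d + (-(d / c)) * c := by rw [Int.emod_def]; ring
  have h4 : d % c ≠ 0 := by
    intro h0
    obtain ⟨t, rfl⟩ := Int.dvd_of_emod_eq_zero h0
    have := Int.isUnit_iff.mp ((IsCoprime.mul_right_iff.mp h).1.isUnit_of_dvd' dvd_rfl dvd_rfl)
    omega
  rcases Int.even_or_odd (d % c) with ho | ho
  · refine ⟨-(d / c) - 1, ?_⟩
    have h5 : d + (-(d / c) - 1) * c = d % c - c := by rw [h3]; ring
    rw [h5]
    exact ⟨ho.sub_odd hc', Or.inr ⟨by omega, by omega⟩⟩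
  · refine ⟨-(d / c), ?_⟩
    rw [← h3]
    exact ⟨ho, Or.inl ⟨by omega, h2⟩⟩

lemma isCoprime_bottom_row (γ : SL(2, ℤ)) : IsCoprime (γ 1 0) (γ 1 1) :=
  ⟨-γ 0 1, γ 0 0, by linear_combination det_eq γ⟩

/-- The transformation law of the eta function for odd positive lower left entry. -/
theorem isEtaMultiplier_etaMultiplier (n : ℕ) : ∀ γ : SL(2, ℤ), γ 1 0 = n → 0 < n → Odd n →
    IsEtaMultiplier γ (etaMultiplier γ) := by
  induction n using Nat.strong_induction_on with
  | _ n ih =>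
    intro γ hγ hn hodd
    have hc' : Odd (γ 1 0) := by rw [hγ]; exact_mod_cast hodd
    rcases Nat.lt_or_ge 1 n with h1 | h1
    -- Euclid's algorithm: a power of T makes the lower right entry d odd with |d| < c. Then S (for
    -- d > 0) or S⁻¹ (for d < 0) moves |d| to the lower left corner, where the induction hypothesis
    -- applies.
    · obtain ⟨k, hk, hk'⟩ := exists_odd_shift (by omega) hc' (isCoprime_bottom_row γ)
      obtain ⟨-, -, h10, h11⟩ := mul_T_zpow_apply γ k
      suffices h : IsEtaMultiplier (γ * T ^ k) (etaMultiplier (γ * T ^ k)) by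
        have := h.mul_T_zpow (-k)
        rwa [zpow_neg, mul_inv_cancel_right, etaMultiplier_mul_T_zpow hc', mul_assoc (_ : ℂ),
          e24_mul_neg, mul_one] at this
      set δ := γ * T ^ k
      rw [← h11] at hk hk'
      rw [← h10] at hk' hc' hγ
      rcases hk' with ⟨h0, hlt⟩ | ⟨h0, hlt⟩
      · obtain ⟨-, -, s10, s11⟩ := mul_S_apply δ
        have hp : ((δ 1 1).toNat : ℤ) = δ 1 1 := by omega
        have ho : Odd (δ 1 1).toNat := by exact_mod_cast hp ▸ hk
        have := ih (δ 1 1).toNat (by omega) (δ * S) (by omega) (by omega) ho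
        have h2 := this.of_mul_S (by omega) h0
        rwa [etaMultiplier_mul_S (by omega) h0 hc' hk, mul_assoc (_ : ℂ), mul_comm (e24 (-3)),
          e24_mul_neg, mul_one] at h2
      · obtain ⟨-, -, s10, s11⟩ := mul_S_inv_apply δ
        have hp : ((-δ 1 1).toNat : ℤ) = -δ 1 1 := by omega
        have ho : Odd (-δ 1 1).toNat := by exact_mod_cast hp ▸ hk.neg
        have := ih (-δ 1 1).toNat (by omega) (δ * S⁻¹) (by omega) (by omega) ho
        have h2 := this.mul_S (by omega) (by omega)
        rwa [← etaMultiplier_mul_S (by omega) (by omega) (by rw [s10]; exact hk.neg)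
          (by rw [s11]; exact hc'), inv_mul_cancel_right] at h2
    · have hn1 : γ 1 0 = 1 := by omega
      have hdet := det_eq γ
      intro z
      have hz : (z : ℂ) + γ 1 1 ≠ 0 := by
        have := (T ^ γ 1 1 • z : ℍ).ne_zero
        rwa [coe_T_zpow_smul'] at this
      -- For c = 1 the determinant gives γz = a - 1/(z + d).
      have hcoe : ((γ • z : ℍ) : ℂ) = -((T ^ γ 1 1 • z : ℍ) : ℂ)⁻¹ + γ 0 0 := by
        rw [UpperHalfPlane.specialLinearGroup_apply, coe_T_zpow_smul']
        have hb : ((γ 0 1 : ℤ) : ℂ) = γ 0 0 * γ 1 1 - 1 := by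
          rw [hn1] at hdet
          have : γ 0 1 = γ 0 0 * γ 1 1 - 1 := by linear_combination -hdet
          exact_mod_cast this
        simp [hn1, hb]
        field_simp
        ring
      rw [hcoe, eta_vadd, eta_neg_inv, coe_T_zpow_smul', eta_vadd, etaMultiplier, sqrtDenom, hn1]
      simp only [Int.natAbs_one, jacobiSym.one_right, Int.cast_one, one_mul]
      rw [show (γ 0 0 + γ 1 1) * 1 - γ 0 1 * γ 1 1 * (1 ^ 2 - 1) - 3 * 1 =
        γ 0 0 + (-3) + γ 1 1 by ring, e24_add, e24_add]
      ring

end PartitionModM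

namespace PartitionModM

open NumberTheorySymbols ZMod ModularGroup

/-! ### From the eta multiplier to the theta multiplier, and η(24z) on Γ₀(576). -/

lemma odd_of_isCoprime_of_even {c d : ℤ} (h : IsCoprime c d) (hc : Even c) : Odd d := by
  obtain ⟨x, y, hxy⟩ := h
  obtain ⟨s, rfl⟩ := hc
  rcases Int.even_or_odd d with ⟨t, rfl⟩ | h'
  · have h2 : (2 : ℤ) * (x * s + y * t) = 1 := by rw [← hxy]; ring
    omega
  · exact h'

/-- The transformation law of the eta function when both off-diagonal entries are divisible
by `24`. -/
lemma isEtaMultiplier_of_dvd {γ : SL(2, ℤ)} (hc : 0 < γ 1 0) (hc' : (24 : ℤ) ∣ γ 1 0)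
    (hb : (24 : ℤ) ∣ γ 0 1) :
    IsEtaMultiplier γ (J(γ 1 0 | (γ 1 1).natAbs) * e24 (3 * (γ 1 1 - 1))) := by
  have hcop := isCoprime_bottom_row γ
  have hdet := det_eq γ
  obtain ⟨c, hc⟩ := hc'
  obtain ⟨b, hb⟩ := hb
  have hd : Odd (γ 1 1) := odd_of_isCoprime_of_even hcop ⟨12 * c, by omega⟩
  have hd0 : γ 1 1 ≠ 0 := by intro h; rw [h] at hd; simp at hd
  rcases lt_or_gt_of_ne hd0 with h0 | h0
  · obtain ⟨s00, s01, s10, s11⟩ := mul_S_inv_apply γ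
    have hp : ((-γ 1 1).toNat : ℤ) = -γ 1 1 := by omega
    have ho : Odd (-γ 1 1).toNat := by exact_mod_cast hp ▸ hd.neg
    have h2 := (isEtaMultiplier_etaMultiplier (-γ 1 1).toNat (γ * S⁻¹) (by omega) (by omega)
      ho).mul_S (by omega) (by omega)
    rw [inv_mul_cancel_right, etaMultiplier, s00, s01, s10, s11, mul_assoc (_ : ℂ), ← e24_add,
      Int.natAbs_neg] at h2
    convert h2 using 2
    apply e24_congr
    rw [Int.modEq_iff_dvd, hb, hc]
    exact ⟨-c * γ 1 1 + b * γ 1 1 - γ 0 0 * c * ((γ 1 1) ^ 2 - 1), by ring⟩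
  · obtain ⟨s00, s01, s10, s11⟩ := mul_S_apply γ
    have hp : ((γ 1 1).toNat : ℤ) = γ 1 1 := by omega
    have ho : Odd (γ 1 1).toNat := by exact_mod_cast hp ▸ hd
    have h2 := (isEtaMultiplier_etaMultiplier (γ 1 1).toNat (γ * S) (by omega) (by omega)
      ho).of_mul_S (by omega) h0
    rw [etaMultiplier, s00, s01, s10, s11, mul_assoc (_ : ℂ), ← e24_add,
      jacobiSym.neg _ (Int.natAbs_odd.mpr hd), chi4_natAbs_pos h0] at h2
    -- The symbol of γS is (-c/d); its factor (-1/d) = χ₄(d) = (-1)^((d-1)/2) is absorbed into the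
    -- exponent as 6(d - 1).
    have hchi : ((χ₄ ((γ 1 1 : ℤ) : ZMod 4) : ℤ) : ℂ) = e24 (6 * (γ 1 1 - 1)) := by
      obtain ⟨t, ht⟩ := hd
      rw [show 6 * (γ 1 1 - 1) = 12 * t by omega, e24_twelve_mul]
      split_ifs with h
      · obtain ⟨u, hu⟩ := h
        rw [ZMod.χ₄_int_one_mod_four (by omega)]
        simp
      · obtain ⟨u, hu⟩ := Int.not_even_iff_odd.mp h
        rw [ZMod.χ₄_int_three_mod_four (by omega)]
        simp
    push_cast at h2
    rw [hchi, mul_comm (e24 _) (_ : ℂ), mul_assoc (_ : ℂ), ← e24_add] at h2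
    convert h2 using 2
    apply e24_congr
    rw [Int.modEq_iff_dvd, hb, hc]
    exact ⟨b * γ 1 1 - c * γ 1 1 - γ 0 0 * c * ((γ 1 1) ^ 2 - 1), by ring⟩

/-- Both sides depend only on d modulo 8. This converts the root of unity of η into the ε_d of θ, at
the cost of a symbol (2/d). -/
lemma e24_three_mul_eq {d : ℤ} (hd : Odd d) :
    e24 (3 * (d - 1)) = (J(2 | d.natAbs) : ℂ) * (epsilon d)⁻¹ := by
  have hn := Int.natAbs_odd.mpr hd
  have h8 : χ₈ (d.natAbs : ZMod 8) = χ₈ ((d : ℤ) : ZMod 8) := by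
    rcases le_total 0 d with h | h
    · have := congrArg (Int.cast : ℤ → ZMod 8) (Int.natAbs_of_nonneg h)
      rw [← this]
      simp
    · have h' := congrArg (Int.cast : ℤ → ZMod 8) (Int.ofNat_natAbs_of_nonpos h)
      rw [Int.cast_natCast, Int.cast_neg] at h'
      rw [h']
      generalize ((d : ℤ) : ZMod 8) = x
      revert x
      decide
  have hmod : ∀ r : ℤ, d % 8 = r → χ₈ ((d : ℤ) : ZMod 8) = χ₈ ((r : ℤ) : ZMod 8) := by
    intro r hr
    congr 1
    rw [ZMod.intCast_eq_intCast_iff, ← hr]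
    exact (Int.mod_modEq _ _).symm
  rw [jacobiSym.at_two hn, h8]
  rw [Int.odd_iff] at hd
  have hr : d % 8 = 1 ∨ d % 8 = 3 ∨ d % 8 = 5 ∨ d % 8 = 7 := by omega
  have hI : Complex.I⁻¹ = -Complex.I := Complex.inv_I
  rcases hr with h | h | h | h
  · rw [hmod _ h, epsilon, if_pos (by omega), show χ₈ ((1 : ℤ) : ZMod 8) = 1 by decide,
      e24_congr (b := 0) (by rw [Int.modEq_iff_dvd]; omega), e24_zero]
    simp
  · rw [hmod _ h, epsilon, if_neg (by omega), show χ₈ ((3 : ℤ) : ZMod 8) = -1 by decide,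
      e24_congr (b := 6) (by rw [Int.modEq_iff_dvd]; omega), e24_six, hI]
    simp
  · rw [hmod _ h, epsilon, if_pos (by omega), show χ₈ ((5 : ℤ) : ZMod 8) = -1 by decide,
      e24_congr (b := 12) (by rw [Int.modEq_iff_dvd]; omega), e24_twelve]
    simp
  · rw [hmod _ h, epsilon, if_neg (by omega), show χ₈ ((7 : ℤ) : ZMod 8) = 1 by decide,
      e24_congr (b := 6 + 12) (by rw [Int.modEq_iff_dvd]; omega), e24_add, e24_six, e24_twelve,
      hI]
    simp

/-- The sign is fixed by the real part: a principal root has nonnegative real part, while i√w has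
negative real part for w in the upper half-plane. -/
lemma cpow_half_neg {w : ℂ} (hw : 0 < w.im) :
    (-w) ^ (1 / 2 : ℂ) = -Complex.I * w ^ (1 / 2 : ℂ) := by
  have h : ((-w) ^ (1 / 2 : ℂ)) ^ 2 = (-Complex.I * w ^ (1 / 2 : ℂ)) ^ 2 := by
    rw [mul_pow, cpow_half_sq, cpow_half_sq, neg_sq, Complex.I_sq, neg_one_mul]
  rcases sq_eq_sq_iff_eq_or_eq_neg.mp h with h | h
  · exact h
  · exfalso
    have h1 := (cpow_half_re_im_pos hw).2
    have h0 : -w ≠ 0 := by rw [neg_ne_zero]; rintro rfl; simp at hw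
    have hre : 0 ≤ ((-w) ^ (1 / 2 : ℂ)).re := by
      have him : (Complex.log (-w) * (1 / 2)).im = (-w).arg / 2 := by
        rw [show (1 / 2 : ℂ) = ((1 / 2 : ℝ) : ℂ) by norm_num, Complex.im_mul_ofReal,
          Complex.log_im]
        ring
      rw [Complex.cpow_def_of_ne_zero h0, Complex.exp_re, him]
      refine mul_nonneg (Real.exp_pos _).le (Real.cos_nonneg_of_mem_Icc ⟨?_, ?_⟩)
      · linarith [Complex.neg_pi_lt_arg (-w)]
      · linarith [Complex.arg_le_pi (-w)]
    rw [h] at hre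
    simp at hre
    norm_num at h1
    linarith

/-- Since -γ and γ act identically, this reduces c < 0 to c > 0. It rests on χ₄(-d)·ε₋d⁻¹·(-i) =
ε_d⁻¹, the -i coming from the branch of the square root. -/
lemma thetaFactor_neg {γ : SL(2, ℤ)} (hc : 0 < γ 1 0) (hd : Odd (γ 1 1)) (z : ℍ) :
    thetaFactor (-γ) z = thetaFactor γ z := by
  have e10 : (-γ) 1 0 = -γ 1 0 := by simp
  have e11 : (-γ) 1 1 = -γ 1 1 := by simp
  have him : 0 < (((γ 1 0 : ℤ) : ℂ) * (z : ℂ) + ((γ 1 1 : ℤ) : ℂ)).im := by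
    have : (0 : ℝ) < γ 1 0 := by exact_mod_cast hc
    simpa using mul_pos this z.2
  have hs : sqrtDenom (-γ) z = -Complex.I * sqrtDenom γ z := by
    rw [sqrtDenom, sqrtDenom, e10, e11, ← cpow_half_neg him]
    congr 1
    push_cast
    ring
  rw [thetaFactor, thetaFactor, hs, e10, e11, quadSymbol_eq_of_neg (by omega) hd.neg,
    quadSymbol_eq_of_nonneg hc.le, neg_neg, Int.natAbs_neg]
  have key : ((χ₄ ((-γ 1 1 : ℤ) : ZMod 4) : ℤ) : ℂ) * (epsilon (-γ 1 1))⁻¹ * -Complex.I =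
      (epsilon (γ 1 1))⁻¹ := by
    rw [Int.odd_iff] at hd
    have hr : γ 1 1 % 4 = 1 ∨ γ 1 1 % 4 = 3 := by omega
    rcases hr with h | h
    · rw [ZMod.χ₄_int_three_mod_four (by omega), epsilon, epsilon, if_pos h, if_neg (by omega)]
      simp
    · rw [ZMod.χ₄_int_one_mod_four (by omega), epsilon, epsilon,
        if_neg (show ¬γ 1 1 % 4 = 1 by omega), if_pos (show -γ 1 1 % 4 = 1 by omega)]
      simp
  rw [← key]
  push_cast
  ring

/-- The point `s z` of the upper half-plane, for `s > 0`. -/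
def scale (s : ℝ) (hs : 0 < s) (z : ℍ) : ℍ := ⟨s * z, by simpa using mul_pos hs z.2⟩

lemma isCoprime_six_of_mem_Gamma0 {γ : SL(2, ℤ)} (hγ : (576 : ℤ) ∣ γ 1 0) :
    IsCoprime (6 : ℤ) (γ 1 1) :=
  (isCoprime_bottom_row γ).of_isCoprime_of_dvd_left (dvd_trans ⟨96, by norm_num⟩ hγ)

lemma coe_smul_eq (γ : SL(2, ℤ)) (z : ℍ) : ((γ • z : ℍ) : ℂ) =
    (((γ 0 0 : ℤ) : ℂ) * z + ((γ 0 1 : ℤ) : ℂ)) / (((γ 1 0 : ℤ) : ℂ) * z + ((γ 1 1 : ℤ) : ℂ)) := by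
  rw [UpperHalfPlane.specialLinearGroup_apply]
  simp

lemma coe_scale (s : ℝ) (hs : 0 < s) (z : ℍ) : (scale s hs z : ℂ) = s * z := rfl

/-- The action of `diag(24, 1) γ diag(24, 1)⁻¹`. -/
lemma exists_scale_smul {γ : SL(2, ℤ)} (hγ : (24 : ℤ) ∣ γ 1 0) :
    ∃ δ : SL(2, ℤ), δ 0 1 = 24 * γ 0 1 ∧ γ 1 0 = 24 * δ 1 0 ∧ δ 1 1 = γ 1 1 ∧
      ∀ (h : (0 : ℝ) < 24) (z : ℍ), scale 24 h (γ • z) = δ • scale 24 h z := by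
  obtain ⟨c, hc⟩ := hγ
  let δ : SL(2, ℤ) := ⟨!![γ 0 0, 24 * γ 0 1; c, γ 1 1], by
    have hdet := det_eq γ
    rw [hc] at hdet
    rw [Matrix.det_fin_two_of]
    linear_combination hdet⟩
  have d00 : δ 0 0 = γ 0 0 := rfl
  have d01 : δ 0 1 = 24 * γ 0 1 := rfl
  have d10 : δ 1 0 = c := rfl
  have d11 : δ 1 1 = γ 1 1 := rfl
  refine ⟨δ, rfl, hc, rfl, fun h z => UpperHalfPlane.ext ?_⟩
  rw [coe_scale, coe_smul_eq, coe_smul_eq, coe_scale, d00, d01, d10, d11, hc, ← mul_div_assoc]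
  congr 1 <;> push_cast <;> ring

/-- Conjugation by diag(24, 1) turns (b, c) into (24b, c/24), both divisible by 24 when 576 divides
c. The remaining symbols combine as (24/d)(2/d) = (3/d) = χ(d). -/
lemma eta_smul_of_pos {γ : SL(2, ℤ)} (hγ : (576 : ℤ) ∣ γ 1 0) (hc : 0 < γ 1 0) (z : ℍ) :
    ModularForm.eta (24 * (γ • z : ℍ)) =
      (chi12 ((γ 1 1 : ℤ) : ZMod 12) : ℂ) * thetaFactor γ z * ModularForm.eta (24 * z) := by
  have h6 := isCoprime_six_of_mem_Gamma0 hγ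
  obtain ⟨c, hc'⟩ := hγ
  have hd : Odd (γ 1 1) := odd_of_isCoprime_of_even (isCoprime_bottom_row γ) ⟨288 * c, by omega⟩
  have hn := Int.natAbs_odd.mpr hd
  obtain ⟨δ, d01, d10, d11, hsm⟩ := exists_scale_smul (γ := γ) ⟨24 * c, by omega⟩
  have d10 : δ 1 0 = 24 * c := by omega
  have h := isEtaMultiplier_of_dvd (γ := δ) (by omega) (by omega) (by omega)
    (scale 24 (by norm_num) z)
  have hs : sqrtDenom δ (scale 24 (by norm_num) z) = sqrtDenom γ z := by
    rw [sqrtDenom, sqrtDenom, coe_scale, d10, d11, hc']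
    congr 1
    push_cast
    ring
  have hJ : J(24 * c | (γ 1 1).natAbs) * J(2 | (γ 1 1).natAbs) =
      chi12 ((γ 1 1 : ℤ) : ZMod 12) * quadSymbol (γ 1 0) (γ 1 1) := by
    have h2 : J(2 | (γ 1 1).natAbs) ^ 2 = 1 := by
      rw [← jacobiSym.pow_left]
      exact jacobiSym_sq_eq_one (h6.of_isCoprime_of_dvd_left (by norm_num))
    have h3 : J(3 | (γ 1 1).natAbs) ^ 2 = 1 := by
      rw [← jacobiSym.pow_left]
      exact jacobiSym_sq_eq_one (h6.of_isCoprime_of_dvd_left (by norm_num))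
    have h24 : J((24 : ℤ) | (γ 1 1).natAbs) = J(2 | (γ 1 1).natAbs) * J(3 | (γ 1 1).natAbs) := by
      rw [show (24 : ℤ) = 4 * (2 * 3) by norm_num, jacobiSym.mul_left, jacobiSym.at_four hn,
        jacobiSym.mul_left, one_mul]
    have h576 : J((576 : ℤ) | (γ 1 1).natAbs) = 1 := by
      rw [show (576 : ℤ) = 4 * (4 * 6 ^ 2) by norm_num, jacobiSym.mul_left, jacobiSym.mul_left,
        jacobiSym.at_four hn, jacobiSym_sq_eq_one h6]
      norm_num
    rw [chi12_intCast_eq h6, quadSymbol_eq_of_nonneg hc.le, hc', jacobiSym.mul_left,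
      jacobiSym.mul_left, h24, h576]
    linear_combination (J(3 | (γ 1 1).natAbs) * J(c | (γ 1 1).natAbs)) * h2
  rw [← hsm, hs, coe_scale, coe_scale, d10, d11, e24_three_mul_eq hd, Complex.ofReal_ofNat] at h
  rw [h, thetaFactor]
  have hJ' := congrArg (Int.cast : ℤ → ℂ) hJ
  push_cast at hJ'
  linear_combination ((epsilon (γ 1 1))⁻¹ * sqrtDenom γ z * ModularForm.eta (24 * z)) * hJ'

/-- `η(24 z)` is a modular form of weight `1 / 2` on `Γ₀(576)` with Nebentypus `χ`. -/
theorem eta_smul {γ : SL(2, ℤ)} (hγ : (576 : ℤ) ∣ γ 1 0) (z : ℍ) :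
    ModularForm.eta (24 * (γ • z : ℍ)) =
      (chi12 ((γ 1 1 : ℤ) : ZMod 12) : ℂ) * thetaFactor γ z * ModularForm.eta (24 * z) := by
  have h6 := isCoprime_six_of_mem_Gamma0 hγ
  rcases lt_trichotomy (γ 1 0) 0 with hc | hc | hc
  · have e10 : (-γ) 1 0 = -γ 1 0 := by simp
    have e11 : (-γ) 1 1 = -γ 1 1 := by simp
    have h := eta_smul_of_pos (γ := -γ) (by rw [e10]; exact hγ.neg_right) (by omega) z
    obtain ⟨c, hc'⟩ := hγ
    have hd : Odd (γ 1 1) := odd_of_isCoprime_of_even (isCoprime_bottom_row γ) ⟨288 * c, by omega⟩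
    have ht := thetaFactor_neg (γ := -γ) (by omega) (by rw [e11]; exact hd.neg) z
    rw [neg_neg] at ht
    rw [ModularGroup.SL_neg_smul, e11, ← ht, chi12_intCast_eq h6.neg_right, Int.natAbs_neg,
      ← chi12_intCast_eq h6] at h
    exact h
  · have hdet := det_eq γ
    rw [hc, mul_zero, sub_zero] at hdet
    have hsm : (24 : ℂ) * ((γ • z : ℍ) : ℂ) = 24 * z + ((24 * (γ 0 1 * γ 1 1) : ℤ) : ℂ) := by
      rw [coe_smul_eq, hc]
      rcases Int.isUnit_iff.mp (IsUnit.of_mul_eq_one _ ((mul_comm _ _).trans hdet)) with h | h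
      · have ha : γ 0 0 = 1 := by rw [h] at hdet; omega
        rw [h, ha]; push_cast; ring
      · have ha : γ 0 0 = -1 := by rw [h] at hdet; omega
        rw [h, ha]; push_cast; ring
    -- Here γ = ±T^b; for d = -1 the factor ε_d⁻¹ = -i cancels √(-1) = i.
    have hj : (chi12 ((γ 1 1 : ℤ) : ZMod 12) : ℂ) * thetaFactor γ z = 1 := by
      rw [chi12_intCast_eq h6, thetaFactor, sqrtDenom, hc]
      rcases Int.isUnit_iff.mp (IsUnit.of_mul_eq_one _ ((mul_comm _ _).trans hdet)) with h | h
      · rw [h]; simp [epsilon, quadSymbol]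
      · rw [h]
        have : (-1 : ℂ) ^ (1 / 2 : ℂ) = Complex.I := by
          rw [Complex.cpow_def_of_ne_zero (by norm_num), Complex.log_neg_one,
            show Real.pi * Complex.I * (1 / 2 : ℂ) = Real.pi / 2 * Complex.I by ring,
            Complex.exp_pi_div_two_mul_I]
        have h2 : (-1 : ℂ) ^ (2⁻¹ : ℂ) = Complex.I := by rw [← this]; norm_num
        simp [epsilon, quadSymbol, h2]
    rw [hsm, eta_vadd, e24_period, hj]
  · exact eta_smul_of_pos hγ hc z

end PartitionModM

namespace PartitionModM

open Filter Topology

/-! ### Convergent power series on the unit disc -/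

/-- The power series `a` converges to `φ` on the open unit disc. -/
def ConvergesTo (a : PowerSeries ℂ) (φ : ℂ → ℂ) : Prop :=
  ∀ q : ℂ, ‖q‖ < 1 → HasSum (fun n => PowerSeries.coeff n a * q ^ n) (φ q)

lemma ConvergesTo.congr {a : PowerSeries ℂ} {φ ψ : ℂ → ℂ} (h : ConvergesTo a φ)
    (hφ : ∀ q, ‖q‖ < 1 → φ q = ψ q) : ConvergesTo a ψ :=
  fun q hq => hφ q hq ▸ h q hq

lemma convergesTo_one : ConvergesTo 1 1 := by
  intro q _
  have : (fun n => PowerSeries.coeff n (1 : PowerSeries ℂ) * q ^ n) =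
      fun n => if n = 0 then 1 else 0 := by
    ext n
    rw [PowerSeries.coeff_one]
    split_ifs with h <;> simp [h]
  rw [this]
  exact hasSum_ite_eq 0 1

lemma convergesTo_X : ConvergesTo PowerSeries.X id := by
  intro q _
  have : (fun n => PowerSeries.coeff n (PowerSeries.X : PowerSeries ℂ) * q ^ n) =
      fun n => if n = 1 then q else 0 := by
    ext n
    rw [PowerSeries.coeff_X]
    split_ifs with h <;> simp [h]
  rw [this]
  exact hasSum_ite_eq 1 q

lemma ConvergesTo.mul {a b : PowerSeries ℂ} {φ ψ : ℂ → ℂ} (ha : ConvergesTo a φ)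
    (hb : ConvergesTo b ψ) : ConvergesTo (a * b) (φ * ψ) := by
  intro q hq
  have h1 := (ha q hq).summable.norm
  have h2 := (hb q hq).summable.norm
  have h3 := summable_norm_sum_mul_antidiagonal_of_summable_norm h1 h2
  have h4 := tsum_mul_tsum_eq_tsum_sum_antidiagonal_of_summable_norm h1 h2
  rw [(ha q hq).tsum_eq, (hb q hq).tsum_eq] at h4
  rw [Pi.mul_apply, h4]
  refine (congrArg (fun f : ℕ → ℂ => HasSum f _) (funext fun n => ?_)).mpr h3.of_norm.hasSum
  rw [PowerSeries.coeff_mul, Finset.sum_mul]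
  refine Finset.sum_congr rfl fun x hx => ?_
  rw [← Finset.HasAntidiagonal.mem_antidiagonal.mp hx, pow_add]
  ring

lemma ConvergesTo.pow {a : PowerSeries ℂ} {φ : ℂ → ℂ} (ha : ConvergesTo a φ) (n : ℕ) :
    ConvergesTo (a ^ n) (φ ^ n) := by
  induction n with
  | zero => simpa using convergesTo_one
  | succ n ih => simpa [pow_succ] using ih.mul ha

lemma ConvergesTo.hasFPowerSeriesOnBall {a : PowerSeries ℂ} {φ : ℂ → ℂ} (ha : ConvergesTo a φ) :
    HasFPowerSeriesOnBall φ (FormalMultilinearSeries.ofScalars ℂ fun n => PowerSeries.coeff n a)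
      0 1 where
  r_le := by
    refine le_of_forall_lt_imp_le_of_dense fun r hr => ?_
    lift r to NNReal using hr.ne_top
    apply FormalMultilinearSeries.le_radius_of_summable
    have h := (ha ((r : ℝ) : ℂ) (by simpa using hr)).summable.norm
    simpa using h
  r_pos := by simp
  hasSum := by
    intro y hy
    rw [← ENNReal.coe_one, Metric.eball_coe, NNReal.coe_one, mem_ball_zero_iff] at hy
    simpa [FormalMultilinearSeries.ofScalars_apply_eq, mul_comm] using ha y hy

lemma ConvergesTo.unique {a b : PowerSeries ℂ} {φ : ℂ → ℂ} (ha : ConvergesTo a φ)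
    (hb : ConvergesTo b φ) : a = b := by
  have h := ha.hasFPowerSeriesOnBall.hasFPowerSeriesAt.eq_formalMultilinearSeries
    hb.hasFPowerSeriesOnBall.hasFPowerSeriesAt
  have h' := FormalMultilinearSeries.ofScalars_series_injective ℂ ℂ h
  ext n
  exact congrFun h' n

lemma ConvergesTo.differentiableOn {a : PowerSeries ℂ} {φ : ℂ → ℂ} (ha : ConvergesTo a φ) :
    DifferentiableOn ℂ φ (Metric.ball 0 1) := by
  have h := ha.hasFPowerSeriesOnBall.differentiableOn
  rwa [← ENNReal.coe_one, Metric.eball_coe, NNReal.coe_one] at h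

lemma exists_convergesTo {φ : ℂ → ℂ} (h : DifferentiableOn ℂ φ (Metric.ball 0 1)) :
    ∃ a, ConvergesTo a φ := by
  refine ⟨PowerSeries.mk fun n => (n.factorial : ℂ)⁻¹ * iteratedDeriv n φ 0, fun q hq => ?_⟩
  have := Complex.hasSum_taylorSeries_on_ball h (z := q) (by simpa using hq)
  refine (congrArg (fun f : ℕ → ℂ => HasSum f _) (funext fun n => ?_)).mpr this
  rw [PowerSeries.coeff_mk, sub_zero, smul_eq_mul, smul_eq_mul]
  ring

/-- No estimate of the coefficients of b is needed: 1/φ is holomorphic on the disc, so its Taylor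
series converges there, and by uniqueness that series is the formal inverse of a. -/
lemma ConvergesTo.inv {a b : PowerSeries ℂ} {φ : ℂ → ℂ} (ha : ConvergesTo a φ)
    (h0 : ∀ q, ‖q‖ < 1 → φ q ≠ 0) (hab : a * b = 1) : ConvergesTo b φ⁻¹ := by
  obtain ⟨d, hd⟩ := exists_convergesTo
    (ha.differentiableOn.inv fun q hq => h0 q (by simpa using hq))
  have h1 : a * d = 1 := (ha.mul hd).unique
    (convergesTo_one.congr fun q hq => (mul_inv_cancel₀ (h0 q hq)).symm)
  have : b = d := by
    calc b = b * (a * d) := by rw [h1, mul_one]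
      _ = (a * b) * d := by ring
      _ = d := by rw [hab, one_mul]
  rw [this]
  exact hd

/-! ### Euler's product and the partition generating function -/

/-- Euler's product `∏ (1 - q ^ n)`. -/
def eulerProd (q : ℂ) : ℂ := ∏' n : ℕ, (1 - q ^ (n + 1))

lemma norm_prod_one_sub_pow_le {q : ℂ} (hq : ‖q‖ < 1) (k n : ℕ) :
    ‖∏ i ∈ Finset.range n, (1 - q ^ (k + i + 1))‖ ≤ Real.exp (1 - ‖q‖)⁻¹ := by
  calc ‖∏ i ∈ Finset.range n, (1 - q ^ (k + i + 1))‖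
      ≤ ∏ i ∈ Finset.range n, Real.exp (‖q‖ ^ i) := by
        rw [norm_prod]
        refine Finset.prod_le_prod (fun _ _ => norm_nonneg _) fun i _ => ?_
        calc ‖1 - q ^ (k + i + 1)‖ ≤ 1 + ‖q‖ ^ (k + i + 1) := by
              simpa using norm_sub_le (1 : ℂ) (q ^ (k + i + 1))
          _ ≤ ‖q‖ ^ i + 1 := by
              rw [add_comm]
              gcongr ?_ + 1
              exact pow_le_pow_of_le_one (norm_nonneg _) hq.le (by omega)
          _ ≤ _ := Real.add_one_le_exp _
    _ = Real.exp (∑ i ∈ Finset.range n, ‖q‖ ^ i) := (Real.exp_sum _ _).symm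
    _ ≤ _ := by
        apply Real.exp_le_exp.mpr
        rw [← tsum_geometric_of_lt_one (norm_nonneg _) hq]
        exact (summable_geometric_of_lt_one (norm_nonneg _) hq).sum_le_tsum _
          fun _ _ => by positivity

/-- The analytic form of Euler's pentagonal number theorem, by which the formal pentagonal series
converges to the product defining η. The work lies in checking summability and the vanishing of the
remainder, both by comparison with a geometric series. -/
lemma hasSum_pow_pentagonal {q : ℂ} (hq : ‖q‖ < 1) :
    HasSum (fun k : ℤ => ((Int.negOnePow k : ℤ) : ℂ) * q ^ pentagonal k) (eulerProd q) := by
  have hgeo := summable_geometric_of_lt_one (norm_nonneg _) hq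
  have hs : Summable (fun k : ℤ => ((Int.negOnePow k : ℤ) : ℂ) * q ^ pentagonal k) := by
    refine Summable.of_norm_bounded (hgeo.comp_injective pentagonal_injective) fun k => ?_
    rw [norm_mul, norm_pow, Function.comp_apply]
    refine mul_le_of_le_one_left (by positivity) ?_
    rcases Int.units_eq_one_or (Int.negOnePow k) with h | h <;> simp [h]
  -- The pentagonal identity pairs the indices -k and k + 1; this regroups the sum over ℤ
  -- accordingly.
  have hs' : HasSum (fun k : ℕ => (-1) ^ k * (q ^ pentagonal (-k) - q ^ pentagonal (k + 1)))
      (∑' k : ℤ, ((Int.negOnePow k : ℤ) : ℂ) * q ^ pentagonal k) := by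
    have h := hs.hasSum
    rw [← neg_injective.hasSum_iff (fun x hx ↦ by absurd hx; use -x; simp)] at h
    convert h.nat_add_neg_add_one using 2 with k
    simp_rw [Function.comp_apply, neg_neg, Int.negOnePow_add]
    simp
    ring
  have hbound : ∀ k n : ℕ, ‖q ^ ((k + 1) * n) * ∏ i ∈ Finset.range (n + 1),
      (1 - q ^ (k + i + 1))‖ ≤ ‖q‖ ^ n * Real.exp (1 - ‖q‖)⁻¹ := by
    intro k n
    rw [norm_mul, norm_pow]
    gcongr ?_ * ?_
    · exact pow_le_pow_of_le_one (norm_nonneg _) hq.le (by nlinarith)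
    · exact norm_prod_one_sub_pow_le hq k (n + 1)
  have hgeo' := hgeo.mul_right (Real.exp (1 - ‖q‖)⁻¹)
  have key := Pentagonal.tprod_one_sub_pow (x := q)
    (tendsto_pow_atTop_nhds_zero_of_norm_lt_one hq)
    (fun k => Summable.of_norm_bounded hgeo' (hbound k))
    (fun k => by
      simp_rw [sub_eq_add_neg]
      apply multipliable_one_add_of_summable
      simp_rw [norm_neg, norm_pow]
      exact hgeo.comp_injective (i := fun n => n + k + 1) fun a b h => by simpa using h)
    hs'.summable ?_
  · rw [eulerProd, key, hs'.tsum_eq]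
    exact hs.hasSum
  · refine squeeze_zero_norm (a := fun k => ‖q‖ ^ k * ∑' n, ‖q‖ ^ n * Real.exp (1 - ‖q‖)⁻¹)
      (fun k => ?_) ?_
    · rw [norm_mul, norm_mul, norm_pow, norm_pow, norm_neg, norm_one, one_pow, one_mul]
      gcongr ?_ * ?_
      · refine pow_le_pow_of_le_one (norm_nonneg _) hq.le ?_
        rw [Nat.le_div_iff_mul_le (by norm_num)]
        nlinarith
      · exact tsum_of_norm_bounded hgeo'.hasSum (hbound k)
    · simpa using (tendsto_pow_atTop_nhds_zero_of_lt_one (norm_nonneg _) hq).mul_const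
        (∑' n, ‖q‖ ^ n * Real.exp (1 - ‖q‖)⁻¹)

lemma convergesTo_pentagonalSeries :
    ConvergesTo (PowerSeries.pentagonalSeries ℂ) eulerProd := by
  intro q hq
  rw [← pentagonal_injective.hasSum_iff fun n hn => by
    rw [PowerSeries.coeff_pentagonalSeries_eq_zero ℂ hn, zero_mul]]
  convert hasSum_pow_pentagonal hq using 2 with k
  rw [Function.comp_apply, PowerSeries.coeff_pentagonalSeries_pentagonal]

lemma map_pentagonalSeries {R S : Type*} [CommRing R] [CommRing S] (f : R →+* S) :
    (PowerSeries.pentagonalSeries R).map f = PowerSeries.pentagonalSeries S := by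
  ext n
  rw [PowerSeries.coeff_map]
  by_cases h : n ∈ Set.range pentagonal
  · obtain ⟨k, rfl⟩ := h
    simp
  · rw [PowerSeries.coeff_pentagonalSeries_eq_zero _ h,
      PowerSeries.coeff_pentagonalSeries_eq_zero _ h, map_zero]

/-- The generating function of the partition numbers. -/
def partitionSeries (R : Type*) [CommRing R] : PowerSeries R :=
  PowerSeries.mk fun n => (p n : R)

lemma map_partitionSeries {R S : Type*} [CommRing R] [CommRing S] (f : R →+* S) :
    (partitionSeries R).map f = partitionSeries S := by
  ext n
  simp [partitionSeries]

-- Both series are infinite products, and their factors 1 - X^i and 1 + X^i + X^(2i) + ⋯ cancel one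
-- by one. The discrete topology on ℤ gives meaning to convergence, and the integral identity then
-- maps to any R.
open PowerSeries PowerSeries.WithPiTopology in
lemma pentagonalSeries_mul_partitionSeries (R : Type*) [CommRing R] :
    pentagonalSeries R * partitionSeries R = 1 := by
  suffices h : pentagonalSeries ℤ * partitionSeries ℤ = 1 by
    have := congrArg (PowerSeries.map (Int.castRingHom R)) h
    rwa [map_mul, map_pentagonalSeries, map_partitionSeries, map_one] at this
  let _ : TopologicalSpace ℤ := ⊥
  have _ : DiscreteTopology ℤ := ⟨rfl⟩
  have hP : Nat.Partition.genFun (fun _ _ => (1 : ℤ)) = partitionSeries ℤ := by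
    ext n
    rw [Nat.Partition.coeff_genFun, partitionSeries, coeff_mk, p]
    simp [Finsupp.prod]
  have h := (hasProd_one_sub_X_pow ℤ).mul (Nat.Partition.hasProd_genFun fun _ _ => (1 : ℤ))
  rw [hP] at h
  refine h.unique ?_
  convert hasProd_one using 2 with i
  have hX : constantCoeff ((X : PowerSeries ℤ) ^ (i + 1)) = 0 := by simp
  have hs := summable_pow_of_constantCoeff_eq_zero hX
  have h1 := tsum_pow_mul_one_sub_of_constantCoeff_eq_zero hX
  rw [hs.tsum_eq_zero_add, pow_zero] at h1
  rw [mul_comm]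
  refine Eq.trans ?_ h1
  simp only [pow_mul]
  congr 3 with j
  congr 1
  exact one_smul ℤ _

lemma eulerProd_ne_zero {q : ℂ} (hq : ‖q‖ < 1) : eulerProd q ≠ 0 := by
  refine tprod_one_add_ne_zero_of_summable (f := fun n => -q ^ (n + 1)) (fun n => ?_) ?_
  · rw [← sub_eq_add_neg, sub_ne_zero]
    intro h
    have := congrArg norm h
    rw [norm_one, norm_pow] at this
    exact absurd this (pow_lt_one₀ (norm_nonneg _) hq (by omega)).ne'
  · simp_rw [norm_neg, norm_pow]
    exact (summable_geometric_of_lt_one (norm_nonneg _) hq).comp_injective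
      (add_left_injective 1)

lemma convergesTo_partitionSeries : ConvergesTo (partitionSeries ℂ) eulerProd⁻¹ :=
  convergesTo_pentagonalSeries.inv (fun _ hq => eulerProd_ne_zero hq)
    (pentagonalSeries_mul_partitionSeries ℂ)

/-! ### Integral `q`-expansions -/

/-- `q = exp(2 π i z)`. -/
def qOf (z : ℂ) : ℂ := Complex.exp (2 * Real.pi * Complex.I * z)

lemma norm_qOf_lt_one (z : ℍ) : ‖qOf z‖ < 1 := UpperHalfPlane.norm_exp_two_pi_I_lt_one z

lemma exp_eq_qOf_pow (n : ℕ) (z : ℂ) :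
    Complex.exp (2 * Real.pi * Complex.I * (n : ℂ) * z) = qOf z ^ n := by
  rw [qOf, ← Complex.exp_nat_mul]
  congr 1
  ring

lemma eta_eq (z : ℂ) :
    ModularForm.eta z = Complex.exp (2 * Real.pi * Complex.I * z / 24) * eulerProd (qOf z) := by
  simp [ModularForm.eta, ModularForm.eta_q, eulerProd, qOf, Function.Periodic.qParam]

/-- The image of an integral power series in `ℂ[[q]]`. -/
abbrev toComplex (a : PowerSeries ℤ) : PowerSeries ℂ := PowerSeries.map (Int.castRingHom ℂ) a

lemma ConvergesTo.hasIntegralQExpansion {a : PowerSeries ℤ} {φ : ℂ → ℂ}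
    (h : ConvergesTo (toComplex a) φ) : HasIntegralQExpansion (fun z => φ (qOf z)) a := by
  intro z
  convert h _ (norm_qOf_lt_one z) using 2 with n
  rw [exp_eq_qOf_pow, PowerSeries.coeff_map]
  simp

/-- Every q ≠ 0 in the unit disc comes from some z in ℍ, and convergence at q = 0 is trivial. -/
lemma HasIntegralQExpansion.exists_convergesTo {f : ℍ → ℂ} {a : PowerSeries ℤ}
    (h : HasIntegralQExpansion f a) :
    ∃ φ, ConvergesTo (toComplex a) φ ∧ ∀ z : ℍ, f z = φ (qOf z) := by
  have h' : ∀ z : ℍ, HasSum (fun n => PowerSeries.coeff n (toComplex a) * qOf z ^ n) (f z) := by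
    intro z
    convert h z using 2 with n
    rw [exp_eq_qOf_pow, PowerSeries.coeff_map]
    simp
  refine ⟨fun q => ∑' n, PowerSeries.coeff n (toComplex a) * q ^ n, fun q hq => ?_,
    fun z => (h' z).tsum_eq.symm⟩
  rcases eq_or_ne q 0 with rfl | hq0
  · refine (summable_of_ne_finset_zero (s := {0}) fun n hn => ?_).hasSum
    rw [Finset.mem_singleton] at hn
    simp [hn]
  · have him := Function.Periodic.im_invQParam_pos_of_norm_lt_one one_pos hq hq0
    have hval : qOf (⟨_, him⟩ : ℍ) = q := by
      have := Function.Periodic.qParam_right_inv one_ne_zero hq0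
      simpa [Function.Periodic.qParam, qOf] using this
    have := (h' ⟨_, him⟩).summable.hasSum
    rwa [hval] at this

lemma HasIntegralQExpansion.mdifferentiable {f : ℍ → ℂ} {a : PowerSeries ℤ}
    (h : HasIntegralQExpansion f a) : MDifferentiable 𝓘(ℂ) 𝓘(ℂ) f := by
  obtain ⟨φ, hφ, hf⟩ := h.exists_convergesTo
  rw [UpperHalfPlane.mdifferentiable_iff]
  have h1 : DifferentiableOn ℂ (fun z => φ (qOf z)) {z | 0 < z.im} := by
    refine hφ.differentiableOn.comp (t := Metric.ball 0 1) ?_ fun z hz => ?_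
    · exact Differentiable.differentiableOn (by unfold qOf; fun_prop)
    · simpa using norm_qOf_lt_one ⟨z, hz⟩
  refine h1.congr fun z hz => ?_
  rw [Function.comp_apply, UpperHalfPlane.ofComplex_apply_of_im_pos hz, hf]

lemma HasIntegralQExpansion.isZeroAtImInfty {f : ℍ → ℂ} {a : PowerSeries ℤ}
    (h : HasIntegralQExpansion f a) (h0 : PowerSeries.coeff 0 a = 0) :
    UpperHalfPlane.IsZeroAtImInfty f := by
  obtain ⟨φ, hφ, hf⟩ := h.exists_convergesTo
  have hφ0 : φ 0 = 0 := by
    have h1 := hφ 0 (by simp)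
    refine h1.unique ?_
    convert hasSum_zero using 2 with n
    rcases eq_or_ne n 0 with rfl | hn
    · rw [PowerSeries.coeff_map, h0]; simp
    · simp [hn]
  have hc : Tendsto φ (𝓝 0) (𝓝 (φ 0)) :=
    (hφ.differentiableOn.differentiableAt (Metric.ball_mem_nhds 0 one_pos)).continuousAt
  rw [hφ0] at hc
  have hq := UpperHalfPlane.qParam_tendsto_atImInfty (h := 1) one_pos
  refine (hc.comp hq).congr fun z => ?_
  rw [hf z]
  simp [qOf, Function.Periodic.qParam]

end PartitionModM

namespace PartitionModM

open Filter Topology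

/-! ### The operator `U_m` -/

/-- The operator `U_m` on power series. -/
def uSeries {R : Type*} [CommRing R] (m : ℕ) (a : PowerSeries R) : PowerSeries R :=
  PowerSeries.mk fun n => PowerSeries.coeff (m * n) a

lemma map_uSeries {R S : Type*} [CommRing R] [CommRing S] (f : R →+* S) (m : ℕ)
    (a : PowerSeries R) : (uSeries m a).map f = uSeries m (a.map f) := by
  ext n
  simp [uSeries]

/-- The series a(q^m) is supported on multiples of m, so only pairs (mi, mj) contribute to the
coefficient of q^(mn). -/
lemma uSeries_expand_mul {R : Type*} [CommRing R] {m : ℕ} (hm : m ≠ 0) (a b : PowerSeries R) :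
    uSeries m (PowerSeries.expand m hm a * b) = a * uSeries m b := by
  ext n
  rw [uSeries, PowerSeries.coeff_mk, PowerSeries.coeff_mul, PowerSeries.coeff_mul]
  symm
  refine Finset.sum_of_injOn (fun x => (m * x.1, m * x.2)) ?_ ?_ ?_ ?_
  · intro x _ y _ h
    simp only [Prod.mk.injEq] at h
    exact Prod.ext (Nat.eq_of_mul_eq_mul_left (Nat.pos_of_ne_zero hm) h.1)
      (Nat.eq_of_mul_eq_mul_left (Nat.pos_of_ne_zero hm) h.2)
  · intro x hx
    rw [Finset.mem_coe, Finset.HasAntidiagonal.mem_antidiagonal] at hx ⊢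
    rw [← hx, mul_add]
  · intro x hx hx'
    rw [Finset.HasAntidiagonal.mem_antidiagonal] at hx
    by_cases h : m ∣ x.1
    · exfalso
      obtain ⟨i, hi⟩ := h
      obtain ⟨j, hj⟩ : m ∣ x.2 := by
        exact (Nat.dvd_add_right ⟨i, hi⟩).mp ⟨n, hx⟩
      refine hx' ⟨(i, j), ?_, Prod.ext hi.symm hj.symm⟩
      rw [Finset.mem_coe, Finset.HasAntidiagonal.mem_antidiagonal]
      refine Nat.eq_of_mul_eq_mul_left (Nat.pos_of_ne_zero hm) ?_
      rw [← hx, hi, hj, mul_add]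
    · rw [PowerSeries.coeff_expand_of_not_dvd _ _ _ h, zero_mul]
  · intro x _
    simp only
    rw [PowerSeries.coeff_expand_mul, uSeries, PowerSeries.coeff_mk]

/-- The point `(z + v) / m` of the upper half-plane. -/
def shiftDiv (m : ℕ) [NeZero m] (v : ℤ) (z : ℍ) : ℍ :=
  ⟨(z + v) / m, by
    have hm : (0 : ℝ) < m := by exact_mod_cast NeZero.pos m
    rw [Complex.div_natCast_im]
    simpa using div_pos z.2 hm⟩

/-- The operator `U_m` on functions on the upper half-plane. -/
def uFun (m : ℕ) [NeZero m] (f : ℍ → ℂ) (z : ℍ) : ℂ :=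
  (m : ℂ)⁻¹ * ∑ v : ZMod m, f (shiftDiv m v.val z)

lemma sum_zmod_val {M : Type*} [AddCommMonoid M] (m : ℕ) [NeZero m] (g : ℕ → M) :
    ∑ v : ZMod m, g v.val = ∑ i ∈ Finset.range m, g i := by
  obtain ⟨k, rfl⟩ := Nat.exists_eq_succ_of_ne_zero (NeZero.ne m)
  exact Fin.sum_univ_eq_sum_range g _

lemma sum_root_pow (m : ℕ) [NeZero m] (n : ℕ) :
    ∑ v : ZMod m, Complex.exp (2 * Real.pi * Complex.I * n * v.val / m) =
      if m ∣ n then (m : ℂ) else 0 := by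
  have hp := Complex.isPrimitiveRoot_exp m (NeZero.ne m)
  set ζ := Complex.exp (2 * Real.pi * Complex.I / m)
  have h : ∀ v : ℕ, Complex.exp (2 * Real.pi * Complex.I * n * v / m) = (ζ ^ n) ^ v := by
    intro v
    rw [← pow_mul, ← Complex.exp_nat_mul]
    congr 1
    push_cast
    ring
  simp_rw [h]
  rw [sum_zmod_val m fun v => (ζ ^ n) ^ v]
  split_ifs with hmn
  · rw [(hp.pow_eq_one_iff_dvd n).mpr hmn]
    simp
  · have h1 : ζ ^ n - 1 ≠ 0 := by
      rw [sub_ne_zero]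
      exact fun h' => hmn ((hp.pow_eq_one_iff_dvd n).mp h')
    refine (mul_eq_zero.mp ?_).resolve_left h1
    rw [mul_geom_sum, ← pow_mul, mul_comm, pow_mul, hp.pow_eq_one, one_pow, sub_self]

/-- Averaging over the shifts kills the exponents not divisible by m, by orthogonality of the m-th
roots of unity. -/
lemma HasIntegralQExpansion.uFun {f : ℍ → ℂ} {a : PowerSeries ℤ} (h : HasIntegralQExpansion f a)
    (m : ℕ) [NeZero m] : HasIntegralQExpansion (uFun m f) (uSeries m a) := by
  intro z
  have hm : (m : ℂ) ≠ 0 := by exact_mod_cast NeZero.ne m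
  have h1 := (hasSum_sum (s := Finset.univ) fun (v : ZMod m) _ =>
    h (shiftDiv m v.val z)).mul_left (m : ℂ)⁻¹
  have h2 : ∀ n : ℕ, (m : ℂ)⁻¹ * ∑ v : ZMod m, ((PowerSeries.coeff n a : ℤ) : ℂ) *
      Complex.exp (2 * Real.pi * Complex.I * n * (shiftDiv m v.val z : ℍ)) =
      if m ∣ n then ((PowerSeries.coeff n a : ℤ) : ℂ) *
        Complex.exp (2 * Real.pi * Complex.I * n * z / m) else 0 := by
    intro n
    have h3 : ∀ v : ZMod m, Complex.exp (2 * Real.pi * Complex.I * n * (shiftDiv m v.val z : ℍ)) =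
        Complex.exp (2 * Real.pi * Complex.I * n * z / m) *
          Complex.exp (2 * Real.pi * Complex.I * n * v.val / m) := by
      intro v
      rw [← Complex.exp_add]
      congr 1
      simp only [shiftDiv]
      push_cast
      ring
    simp_rw [h3]
    rw [← Finset.mul_sum, ← Finset.mul_sum, sum_root_pow]
    split_ifs
    · field_simp
    · ring
  simp_rw [h2] at h1
  have hinj : Function.Injective fun n : ℕ => m * n :=
    fun a b hab => Nat.eq_of_mul_eq_mul_left (NeZero.pos m) hab
  rw [← hinj.hasSum_iff fun n hn => by
    rw [if_neg]
    rintro ⟨k, rfl⟩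
    exact hn ⟨k, rfl⟩] at h1
  refine (congrArg (fun f : ℕ → ℂ => HasSum f _) (funext fun n => ?_)).mpr h1
  rw [Function.comp_apply, if_pos (Dvd.intro n rfl), uSeries, PowerSeries.coeff_mk]
  congr 2
  push_cast
  field_simp

lemma HasIntegralQExpansion.expand {f : ℍ → ℂ} {a : PowerSeries ℤ}
    (h : HasIntegralQExpansion f a) {m : ℕ} (hm : m ≠ 0) (hm' : (0 : ℝ) < m) :
    HasIntegralQExpansion (fun z => f (scale m hm' z)) (PowerSeries.expand m hm a) := by
  intro z
  have h1 := h (scale m hm' z)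
  have hinj : Function.Injective fun n : ℕ => m * n :=
    fun a b hab => Nat.eq_of_mul_eq_mul_left (Nat.pos_of_ne_zero hm) hab
  rw [← hinj.hasSum_iff fun n hn => by
    rw [PowerSeries.coeff_expand_of_not_dvd]
    · simp
    · rintro ⟨k, rfl⟩
      exact hn ⟨k, rfl⟩]
  refine (congrArg (fun f : ℕ → ℂ => HasSum f _) (funext fun n => ?_)).mpr h1
  rw [Function.comp_apply, PowerSeries.coeff_expand_mul]
  congr 2
  simp only [scale]
  push_cast
  ring

lemma HasIntegralQExpansion.add {f g : ℍ → ℂ} {a b : PowerSeries ℤ}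
    (hf : HasIntegralQExpansion f a) (hg : HasIntegralQExpansion g b) :
    HasIntegralQExpansion (fun z => f z + g z) (a + b) := by
  intro z
  simpa [add_mul] using (hf z).add (hg z)

lemma HasIntegralQExpansion.const_mul {f : ℍ → ℂ} {a : PowerSeries ℤ}
    (hf : HasIntegralQExpansion f a) (c : ℤ) :
    HasIntegralQExpansion (fun z => c * f z) (PowerSeries.C c * a) := by
  intro z
  refine (congrArg (fun f : ℕ → ℂ => HasSum f _) (funext fun n => ?_)).mpr
    ((hf z).mul_left (c : ℂ))
  rw [PowerSeries.coeff_C_mul]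
  push_cast
  ring

/-- Division of a `q`-expansion that vanishes to order `m` by `q ^ m`. -/
lemma HasIntegralQExpansion.shift {f : ℍ → ℂ} {a : PowerSeries ℤ}
    (hf : HasIntegralQExpansion f a) {m : ℕ} (h0 : ∀ n < m, PowerSeries.coeff n a = 0) :
    HasIntegralQExpansion (fun z => f z / qOf z ^ m)
      (PowerSeries.mk fun n => PowerSeries.coeff (n + m) a) := by
  intro z
  have hq : qOf z ≠ 0 := Complex.exp_ne_zero _
  have h1 := (hasSum_nat_add_iff' m).mpr (hf z)
  rw [Finset.sum_eq_zero fun n hn => by rw [h0 n (Finset.mem_range.mp hn)]; simp, sub_zero] at h1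
  refine (congrArg (fun f : ℕ → ℂ => HasSum f _) (funext fun n => ?_)).mpr
    (h1.div_const (qOf z ^ m))
  rw [PowerSeries.coeff_mk, exp_eq_qOf_pow, exp_eq_qOf_pow, pow_add]
  field_simp

/-! ### The reduction modulo `m` -/

/-- Frobenius, which is the identity on the coefficients in ℤ/m. -/
lemma expand_eq_pow {m : ℕ} [Fact m.Prime] (hm : m ≠ 0) (f : PowerSeries (ZMod m)) :
    PowerSeries.expand m hm f = f ^ m := by
  have h := MvPowerSeries.map_frobenius_expand (R := ZMod m) m hm (f := f)
  rw [ZMod.frobenius_zmod, MvPowerSeries.map_id] at h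
  exact h

/-- The series `q ^ N ∏ (1 - q ^ n) ^ (24 N)`, the `q`-expansion of `Δ ^ N`. -/
def deltaPowSeries (R : Type*) [CommRing R] (N : ℕ) : PowerSeries R :=
  PowerSeries.X ^ N * PowerSeries.pentagonalSeries R ^ (24 * N)

/-- The `q`-expansion of `Δ ^ N | T_m`. -/
def heckeSeries (m : ℕ) (hm : m ≠ 0) (N : ℕ) : PowerSeries ℤ :=
  PowerSeries.C ((m : ℤ) ^ (12 * N - 1)) * PowerSeries.expand m hm (deltaPowSeries ℤ N) +
    uSeries m (deltaPowSeries ℤ N)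

/-- The `q`-expansion of `(Δ ^ N | T_m) / ∏ (1 - q ^ n) ^ m`. -/
def quotSeries (m : ℕ) (hm : m ≠ 0) (N : ℕ) : PowerSeries ℤ :=
  heckeSeries m hm N * partitionSeries ℤ ^ m

/-- The `q`-expansion of `(Δ ^ N | T_m)(24 z) / η(24 z) ^ m`. -/
def formSeries (m : ℕ) (hm : m ≠ 0) (N : ℕ) : PowerSeries ℤ :=
  PowerSeries.mk fun n =>
    PowerSeries.coeff (n + m) (PowerSeries.expand 24 (by norm_num) (quotSeries m hm N))

lemma coeff_deltaPowSeries_of_lt {R : Type*} [CommRing R] {N n : ℕ} (h : n < N) :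
    PowerSeries.coeff n (deltaPowSeries R N) = 0 := by
  rw [deltaPowSeries, PowerSeries.coeff_X_pow_mul', if_neg (by omega)]

/-- Since Δ^N begins at q^N, it suffices that mn < N. If 24n < m then 24mn ≤ m² - m < m² - 1 = 24N;
equality 24n = m contradicts m² = 24N + 1. Including the bound 24n = m is what leaves no constant
term after division by η(24z)^m. -/
lemma coeff_heckeSeries_of_le {m N : ℕ} (hm : m ≠ 0) (h1 : 1 < m) (hN : m ^ 2 = 24 * N + 1)
    {n : ℕ} (h : 24 * n ≤ m) : PowerSeries.coeff n (heckeSeries m hm N) = 0 := by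
  have h2 : m * n < N ∨ 24 * n = m := by
    rcases Nat.lt_or_ge (24 * n) m with h' | h'
    · left; nlinarith
    · right; omega
  have hmn : m * n < N := by
    rcases h2 with h2 | h2
    · exact h2
    · exfalso
      rw [← h2] at hN
      have : 24 * (24 * n ^ 2) = 24 * N + 1 := by rw [← hN]; ring
      omega
  rw [heckeSeries, map_add, PowerSeries.coeff_C_mul, uSeries, PowerSeries.coeff_mk,
    coeff_deltaPowSeries_of_lt hmn, PowerSeries.coeff_expand, add_zero]
  split_ifs
  · rw [coeff_deltaPowSeries_of_lt, mul_zero]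
    calc n / m ≤ n := Nat.div_le_self _ _
      _ ≤ m * n := Nat.le_mul_of_pos_left _ (by omega)
      _ < N := hmn
  · rw [mul_zero]

lemma coeff_quotSeries_of_le {m N : ℕ} (hm : m ≠ 0) (h1 : 1 < m) (hN : m ^ 2 = 24 * N + 1)
    {n : ℕ} (h : 24 * n ≤ m) : PowerSeries.coeff n (quotSeries m hm N) = 0 := by
  have hd : PowerSeries.X ^ (n + 1) ∣ heckeSeries m hm N := by
    rw [PowerSeries.X_pow_dvd_iff]
    intro i hi
    exact coeff_heckeSeries_of_le hm h1 hN (by omega)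
  exact PowerSeries.X_pow_dvd_iff.mp (hd.mul_right _) n (by omega)

lemma coeff_expand_quotSeries_of_le {m N : ℕ} (hm : m ≠ 0) (h1 : 1 < m)
    (hN : m ^ 2 = 24 * N + 1) {n : ℕ} (h : n ≤ m) :
    PowerSeries.coeff n (PowerSeries.expand 24 (by norm_num) (quotSeries m hm N)) = 0 := by
  rw [PowerSeries.coeff_expand]
  split_ifs with hd
  · exact coeff_quotSeries_of_le hm h1 hN (by omega)
  · rfl

/-- The congruence at the heart of the proof. The first term of T_m dies because 12N - 1 > 0, and
E^(24N) = E^(m²)·P lets U_m release the factor E^m, which the division then cancels. -/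
lemma map_quotSeries {m N : ℕ} [Fact m.Prime] (hm : m ≠ 0) (hN : m ^ 2 = 24 * N + 1)
    (hN0 : 0 < N) : (quotSeries m hm N).map (Int.castRingHom (ZMod m)) =
      uSeries m (PowerSeries.X ^ N * partitionSeries (ZMod m)) := by
  have hd : (deltaPowSeries ℤ N).map (Int.castRingHom (ZMod m)) = deltaPowSeries (ZMod m) N := by
    rw [deltaPowSeries, map_mul, map_pow, map_pow, PowerSeries.map_X, map_pentagonalSeries,
      deltaPowSeries]
  have hE := pentagonalSeries_mul_partitionSeries (ZMod m)
  have hC : (PowerSeries.C ((m : ℤ) ^ (12 * N - 1))).map (Int.castRingHom (ZMod m)) = 0 := by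
    rw [PowerSeries.map_C, map_pow]
    simp [show 12 * N - 1 ≠ 0 by omega]
  have hfac : deltaPowSeries (ZMod m) N =
      PowerSeries.expand m hm (PowerSeries.pentagonalSeries (ZMod m) ^ m) *
        (PowerSeries.X ^ N * partitionSeries (ZMod m)) := by
    rw [expand_eq_pow, ← pow_mul, ← pow_two, hN, deltaPowSeries, pow_succ]
    linear_combination (-PowerSeries.X ^ N * PowerSeries.pentagonalSeries (ZMod m) ^ (24 * N)) * hE
  rw [quotSeries, map_mul, map_pow, map_partitionSeries, heckeSeries, map_add, map_mul, hC,
    zero_mul, zero_add, map_uSeries, hd, hfac, uSeries_expand_mul]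
  calc _ = (PowerSeries.pentagonalSeries (ZMod m) * partitionSeries (ZMod m)) ^ m *
        uSeries m (PowerSeries.X ^ N * partitionSeries (ZMod m)) := by ring
    _ = _ := by rw [hE, one_pow, one_mul]

/-- The exponent k corresponds to 24n = k + m, and then mn - N = (mk + 1)/24 because m² = 24N + 1.
-/
lemma map_formSeries {m N : ℕ} [Fact m.Prime] (hm : m ≠ 0) (hN : m ^ 2 = 24 * N + 1)
    (hN0 : 0 < N) : (formSeries m hm N).map (Int.castRingHom (ZMod m)) = F m 1 := by
  ext k
  rw [formSeries, PowerSeries.coeff_map, PowerSeries.coeff_mk, ← PowerSeries.coeff_map,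
    PowerSeries.map_expand, map_quotSeries hm hN hN0, PowerSeries.coeff_expand, F,
    PowerSeries.coeff_mk, pow_one]
  -- Multiplication by m exchanges the two conditions, as m² ≡ 1 modulo 24.
  have hiff : 24 ∣ k + m ↔ 24 ∣ m * k + 1 := by
    constructor
    · rintro ⟨t, ht⟩
      refine (Nat.dvd_add_left (Dvd.intro N rfl : 24 ∣ 24 * N)).mp ⟨m * t, ?_⟩
      calc m * k + 1 + 24 * N = m * k + m ^ 2 := by rw [hN]; ring
        _ = m * (k + m) := by ring
        _ = 24 * (m * t) := by rw [ht]; ring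
    · rintro ⟨t, ht⟩
      refine (Nat.dvd_add_left (Dvd.intro (N * k) rfl : 24 ∣ 24 * (N * k))).mp ⟨m * t, ?_⟩
      calc k + m + 24 * (N * k) = (24 * N + 1) * k + m := by ring
        _ = m * (m * k + 1) := by rw [← hN]; ring
        _ = 24 * (m * t) := by rw [ht]; ring
  by_cases h : 24 ∣ k + m
  · rw [if_pos h, if_pos (hiff.mp h), uSeries, PowerSeries.coeff_mk,
      PowerSeries.coeff_X_pow_mul', partitionSeries, PowerSeries.coeff_mk]
    obtain ⟨n, hn⟩ := h
    have h24 : m * k + 1 + 24 * N = 24 * (m * n) := by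
      calc m * k + 1 + 24 * N = m * k + m ^ 2 := by rw [hN]; ring
        _ = m * (k + m) := by ring
        _ = 24 * (m * n) := by rw [hn]; ring
    rw [hn, Nat.mul_div_cancel_left _ (by norm_num), if_pos (by omega)]
    congr 2
    omega
  · rw [if_neg h, if_neg fun h' => h (hiff.mpr h')]

lemma F_succ (m k : ℕ) : F m (k + 1) = uSeries m (F m k) := by
  ext n
  simp only [F, uSeries, PowerSeries.coeff_mk, pow_succ, mul_assoc]

end PartitionModM

namespace PartitionModM

open NumberTheorySymbols Filter Topology

/-! ### Vanishing at the cusps -/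

/-- `|f(γ z)|`, scaled by the weight `2 w`, tends to `0` at `i∞` for all `γ ∈ SL₂(ℤ)`. -/
def VanishesAtCusps (w : ℝ) (f : ℍ → ℂ) : Prop :=
  ∀ γ : SL(2, ℤ), Tendsto (fun z : ℍ => ((γ • z).im / z.im) ^ w * ‖f (γ • z)‖)
    UpperHalfPlane.atImInfty (𝓝 0)

lemma sqrtDenom_sq (γ : SL(2, ℤ)) (z : ℍ) :
    sqrtDenom γ z ^ 2 = ((γ 1 0 : ℤ) : ℂ) * (z : ℂ) + ((γ 1 1 : ℤ) : ℂ) := cpow_half_sq _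

lemma denom_ne_zero' (γ : SL(2, ℤ)) (z : ℍ) :
    ((γ 1 0 : ℤ) : ℂ) * (z : ℂ) + ((γ 1 1 : ℤ) : ℂ) ≠ 0 := by
  rw [← ModularGroup.denom_apply]
  exact UpperHalfPlane.denom_ne_zero _ z

lemma sqrtDenom_ne_zero (γ : SL(2, ℤ)) (z : ℍ) : sqrtDenom γ z ≠ 0 := by
  have h := denom_ne_zero' γ z
  rw [← sqrtDenom_sq] at h
  exact fun h' => h (by rw [h']; norm_num)

lemma im_smul_div_im (γ : SL(2, ℤ)) (z : ℍ) :
    (γ • z).im / z.im = ‖sqrtDenom γ z‖ ^ (-4 : ℝ) := by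
  have h0 := norm_pos_iff.mpr (sqrtDenom_ne_zero γ z)
  rw [ModularGroup.im_smul_eq_div_normSq, ModularGroup.denom_apply, ← sqrtDenom_sq,
    Complex.normSq_eq_norm_sq, norm_pow, div_div_cancel_left' z.im_pos.ne', Real.rpow_neg h0.le]
  norm_cast
  rw [← pow_mul]

/-- Im γz / Im z = |cz + d|⁻², so weight κ/2 becomes the exponent κ/4. The real form avoids branches
and multipliers and composes well with affine maps. -/
lemma vanishesAtCusps_iff (κ : ℤ) (f : ℍ → ℂ) : VanishesAtCusps (κ / 4) f ↔
    ∀ γ : SL(2, ℤ), UpperHalfPlane.IsZeroAtImInfty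
      fun z : ℍ => sqrtDenom γ z ^ (-κ) * f (γ • z) := by
  refine forall_congr' fun γ => ?_
  rw [UpperHalfPlane.IsZeroAtImInfty, ZeroAtFilter]
  have : ∀ z : ℍ, ((γ • z).im / z.im) ^ (κ / 4 : ℝ) * ‖f (γ • z)‖ =
      ‖sqrtDenom γ z ^ (-κ) * f (γ • z)‖ := by
    intro z
    have h0 := norm_pos_iff.mpr (sqrtDenom_ne_zero γ z)
    rw [im_smul_div_im, norm_mul, norm_zpow, ← Real.rpow_mul h0.le, ← Real.rpow_intCast]
    congr 2
    push_cast
    ring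
  simp_rw [this]
  exact tendsto_zero_iff_norm_tendsto_zero.symm

/-- The affine map `z ↦ r z + b` of the upper half-plane. -/
def affine (r : ℝ) (hr : 0 < r) (b : ℝ) (z : ℍ) : ℍ :=
  ⟨r * z + b, by simpa using mul_pos hr z.2⟩

lemma coe_affine (r : ℝ) (hr : 0 < r) (b : ℝ) (z : ℍ) : (affine r hr b z : ℂ) = r * z + b := rfl

lemma im_affine (r : ℝ) (hr : 0 < r) (b : ℝ) (z : ℍ) : (affine r hr b z).im = r * z.im := by
  rw [← UpperHalfPlane.coe_im, coe_affine]
  simp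

lemma tendsto_affine (r : ℝ) (hr : 0 < r) (b : ℝ) :
    Tendsto (affine r hr b) UpperHalfPlane.atImInfty UpperHalfPlane.atImInfty := by
  rw [UpperHalfPlane.atImInfty, tendsto_comap_iff]
  have : UpperHalfPlane.im ∘ affine r hr b = fun z => r * z.im := by
    ext z
    exact im_affine r hr b z
  rw [this]
  exact tendsto_comap.const_mul_atTop hr

/-- An integral matrix of positive determinant is an element of SL₂(ℤ) times an upper triangular
one; this is applied to (A B; 0 D)γ. -/
lemma exists_affine_smul {A B D : ℤ} (hA : 0 < A) (hD : 0 < D) (hr : (0 : ℝ) < A / D)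
    (γ : SL(2, ℤ)) : ∃ (γ' : SL(2, ℤ)) (r : ℝ) (hr' : 0 < r) (b : ℝ),
      ∀ z : ℍ, affine (A / D) hr (B / D) (γ • z) = γ' • affine r hr' b z := by
  have hdet := det_eq γ
  set P := A * γ 0 0 + B * γ 1 0 with hP
  set Q := A * γ 0 1 + B * γ 1 1 with hQ
  have hpq : P * (D * γ 1 1) - Q * (D * γ 1 0) = A * D := by
    rw [hP, hQ]; linear_combination A * D * hdet
  have hg : 0 < Int.gcd P (D * γ 1 0) := by
    apply Nat.pos_of_ne_zero
    intro h
    obtain ⟨h1, h2⟩ := Int.gcd_eq_zero_iff.mp h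
    rw [h1, h2] at hpq
    have := mul_pos hA hD
    linarith
  obtain ⟨p₀, hp₀⟩ := Int.gcd_dvd_left P (D * γ 1 0)
  obtain ⟨r₀, hr₀⟩ := Int.gcd_dvd_right P (D * γ 1 0)
  set g : ℤ := (Int.gcd P (D * γ 1 0) : ℤ) with hgdef
  have hg0 : 0 < g := Int.natCast_pos.mpr hg
  -- Bézout coefficients complete the first column, divided by its gcd g, to a matrix of determinant
  -- 1.
  obtain ⟨u, v, huv⟩ : ∃ u v : ℤ, u * p₀ + v * r₀ = 1 := by
    refine ⟨Int.gcdA P (D * γ 1 0), Int.gcdB P (D * γ 1 0), ?_⟩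
    have h := Int.gcd_eq_gcd_ab P (D * γ 1 0)
    rw [← hgdef] at h
    refine mul_left_cancel₀ hg0.ne' ?_
    linear_combination -h - Int.gcdA P (D * γ 1 0) * hp₀ - Int.gcdB P (D * γ 1 0) * hr₀
  set S := D * γ 1 1 with hS
  have hgD : g * (p₀ * S - r₀ * Q) = A * D := by
    linear_combination hpq - S * hp₀ + Q * hr₀
  have hD' : 0 < p₀ * S - r₀ * Q := by
    by_contra h
    push Not at h
    nlinarith [mul_pos hA hD]
  set D' := p₀ * S - r₀ * Q with hD'def
  let γ' : SL(2, ℤ) := ⟨!![p₀, -v; r₀, u], by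
    rw [Matrix.det_fin_two_of]; linear_combination huv⟩
  have hgR : (0 : ℝ) < g := by exact_mod_cast hg0
  have hDR : (0 : ℝ) < D' := by exact_mod_cast hD'
  refine ⟨γ', g / D', by positivity, (u * Q + v * S : ℤ) / D', fun z => ?_⟩
  apply UpperHalfPlane.ext
  have e00 : γ' 0 0 = p₀ := rfl
  have e01 : γ' 0 1 = -v := rfl
  have e10 : γ' 1 0 = r₀ := rfl
  have e11 : γ' 1 1 = u := rfl
  have hden := denom_ne_zero' γ z
  have hDC : (D : ℂ) ≠ 0 := by exact_mod_cast hD.ne'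
  have hDC' : (D' : ℂ) ≠ 0 := by exact_mod_cast hD'.ne'
  set y := affine (g / D') (by positivity) ((u * Q + v * S : ℤ) / D') z with hy
  have hyc : (y : ℂ) = (g * z + (u * Q + v * S)) / D' := by
    rw [hy, coe_affine]
    push_cast
    ring
  have hden' := denom_ne_zero' γ' y
  rw [coe_smul_eq γ', coe_affine, coe_smul_eq γ]
  rw [e00, e01, e10, e11]
  rw [e10, e11] at hden'
  push_cast at hden' ⊢
  have c1 : (g : ℂ) * p₀ = A * ((γ 0 0 : ℤ) : ℂ) + B * ((γ 1 0 : ℤ) : ℂ) := by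
    rw [hP] at hp₀; exact_mod_cast hp₀.symm
  have c2 : (g : ℂ) * r₀ = D * ((γ 1 0 : ℤ) : ℂ) := by exact_mod_cast hr₀.symm
  have c3 : (Q : ℂ) = A * ((γ 0 1 : ℤ) : ℂ) + B * ((γ 1 1 : ℤ) : ℂ) := by exact_mod_cast hQ
  have c4 : (S : ℂ) = D * ((γ 1 1 : ℤ) : ℂ) := by exact_mod_cast hS
  have c5 : (D' : ℂ) = p₀ * S - r₀ * Q := by exact_mod_cast hD'def
  have c6 : (u : ℂ) * p₀ + v * r₀ = 1 := by exact_mod_cast huv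
  have n1 : (p₀ : ℂ) * y + -v = (A * (((γ 0 0 : ℤ) : ℂ) * z + ((γ 0 1 : ℤ) : ℂ)) +
      B * (((γ 1 0 : ℤ) : ℂ) * z + ((γ 1 1 : ℤ) : ℂ))) / D' := by
    rw [hyc, eq_div_iff hDC', add_mul, mul_assoc, div_mul_cancel₀ _ hDC']
    linear_combination (z : ℂ) * c1 + c3 + Q * c6 - v * c5
  have n2 : (r₀ : ℂ) * y + u =
      D * (((γ 1 0 : ℤ) : ℂ) * z + ((γ 1 1 : ℤ) : ℂ)) / D' := by
    rw [hyc, eq_div_iff hDC', add_mul, mul_assoc, div_mul_cancel₀ _ hDC']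
    linear_combination (z : ℂ) * c2 + c4 + S * c6 + u * c5
  rw [n1, n2]
  generalize ((γ 1 0 : ℤ) : ℂ) * z + ((γ 1 1 : ℤ) : ℂ) = X at hden ⊢
  field_simp

/-- After the factorisation at γ, the quotient of imaginary parts changes only by a positive
constant. -/
lemma VanishesAtCusps.comp_affine {w : ℝ} {f : ℍ → ℂ} (hf : VanishesAtCusps w f) {A B D : ℤ}
    (hA : 0 < A) (hD : 0 < D) (hr : (0 : ℝ) < A / D) :
    VanishesAtCusps w fun z => f (affine (A / D) hr (B / D) z) := by
  intro γ
  obtain ⟨γ', r, hr', b, h⟩ := exists_affine_smul (B := B) hA hD hr γ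
  have h1 := ((hf γ').comp (tendsto_affine r hr' b)).const_mul ((r / (A / D)) ^ w)
  rw [mul_zero] at h1
  refine h1.congr fun z => ?_
  have him := im_affine (A / D) hr (B / D) (γ • z)
  rw [h] at him
  simp only [Function.comp_apply, h]
  rw [← mul_assoc, im_affine, him]
  have p1 := z.im_pos
  have p2 := (γ • z).im_pos
  rw [← Real.mul_rpow (by positivity) (by positivity)]
  congr 2
  field_simp

/-! ### `U_m` on cusp forms of half-integral weight -/

lemma shiftDiv_eq_affine (m : ℕ) [NeZero m] (v : ℤ)
    (h : (0 : ℝ) < (1 : ℤ) / (m : ℤ)) (z : ℍ) :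
    shiftDiv m v z = affine ((1 : ℤ) / (m : ℤ)) h ((v : ℤ) / (m : ℤ)) z := by
  apply UpperHalfPlane.ext
  rw [coe_affine, shiftDiv]
  push_cast
  ring

/-- The matrix `(1 v; 0 m) γ (1 w; 0 m)⁻¹` is integral for a suitable `w` and acts accordingly. -/
lemma exists_shiftDiv_smul {m : ℕ} [NeZero m] {γ : SL(2, ℤ)} {v w : ℤ}
    (h : (m : ℤ) ∣ γ 0 1 + v * γ 1 1 - (γ 0 0 + v * γ 1 0) * w) :
    ∃ γ' : SL(2, ℤ), γ' 1 0 = m * γ 1 0 ∧ γ' 1 1 = γ 1 1 - γ 1 0 * w ∧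
      ∀ z : ℍ, shiftDiv m v (γ • z) = γ' • shiftDiv m w z := by
  obtain ⟨t, ht⟩ := h
  have hdet := det_eq γ
  have hm : (m : ℂ) ≠ 0 := by exact_mod_cast NeZero.ne m
  let γ' : SL(2, ℤ) := ⟨!![γ 0 0 + v * γ 1 0, t; m * γ 1 0, γ 1 1 - γ 1 0 * w], by
    rw [Matrix.det_fin_two_of]; linear_combination hdet + γ 1 0 * ht⟩
  refine ⟨γ', rfl, rfl, fun z => ?_⟩
  apply UpperHalfPlane.ext
  have e00 : γ' 0 0 = γ 0 0 + v * γ 1 0 := rfl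
  have e01 : γ' 0 1 = t := rfl
  have e10 : γ' 1 0 = m * γ 1 0 := rfl
  have e11 : γ' 1 1 = γ 1 1 - γ 1 0 * w := rfl
  have hden := denom_ne_zero' γ z
  have ht' : ((γ 0 1 : ℤ) : ℂ) + v * ((γ 1 1 : ℤ) : ℂ) -
      (((γ 0 0 : ℤ) : ℂ) + v * ((γ 1 0 : ℤ) : ℂ)) * w = m * t := by exact_mod_cast ht
  have hs : ∀ (x : ℤ) (y : ℍ), (shiftDiv m x y : ℂ) = (y + x) / m := fun _ _ => rfl
  rw [coe_smul_eq γ', hs, hs, coe_smul_eq γ, e00, e01, e10, e11]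
  push_cast
  have hd : (m : ℂ) * ((γ 1 0 : ℤ) : ℂ) * ((z + w) / m) +
      (((γ 1 1 : ℤ) : ℂ) - ((γ 1 0 : ℤ) : ℂ) * w) =
      ((γ 1 0 : ℤ) : ℂ) * z + ((γ 1 1 : ℤ) : ℂ) := by
    field_simp
    ring
  rw [hd, div_add' _ _ _ hden, div_div, div_eq_div_iff (mul_ne_zero hden hm) hden]
  have : (((γ 0 0 : ℤ) : ℂ) + v * ((γ 1 0 : ℤ) : ℂ)) * ((z + w) / m) + t =
      (((γ 0 0 : ℤ) : ℂ) * z + ((γ 0 1 : ℤ) : ℂ) +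
        v * (((γ 1 0 : ℤ) : ℂ) * z + ((γ 1 1 : ℤ) : ℂ))) / m := by
    rw [eq_div_iff hm, add_mul, mul_assoc, div_mul_cancel₀ _ hm]
    linear_combination -ht'
  rw [this]
  field_simp

/-- The new denominator mc(z + w)/m + d - cw equals cz + d, and ε is unchanged since 4 divides c;
only the quadratic symbol picks up (m/d). -/
lemma thetaFactor_shiftDiv {m : ℕ} [NeZero m] {γ γ' : SL(2, ℤ)} {w : ℤ}
    (hγ : (576 * m : ℤ) ∣ γ 1 0) (h10 : γ' 1 0 = m * γ 1 0)
    (h11 : γ' 1 1 = γ 1 1 - γ 1 0 * w) (z : ℍ) :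
    thetaFactor γ' (shiftDiv m w z) = J(m | (γ 1 1).natAbs) * thetaFactor γ z := by
  have hm : (m : ℂ) ≠ 0 := by exact_mod_cast NeZero.ne m
  have hs : sqrtDenom γ' (shiftDiv m w z) = sqrtDenom γ z := by
    rw [sqrtDenom, sqrtDenom, h10, h11]
    congr 1
    have : (shiftDiv m w z : ℂ) = (z + w) / m := rfl
    rw [this]
    push_cast
    field_simp
    ring
  have he : epsilon (γ' 1 1) = epsilon (γ 1 1) := by
    obtain ⟨t, ht⟩ := hγ
    have : γ' 1 1 % 4 = γ 1 1 % 4 := by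
      rw [h11, ht, show γ 1 1 - 576 * m * t * w = γ 1 1 + 4 * (-144 * m * t * w) by ring,
        Int.add_mul_emod_self_left]
    rw [epsilon, epsilon, this]
  rw [thetaFactor, thetaFactor, hs, he, h10, h11,
    quadSymbol_natCast_mul_sub (NeZero.pos m) hγ (isCoprime_bottom_row γ)]
  push_cast
  ring

lemma dvd_of_mem_Gamma0 {N : ℕ} {γ : SL(2, ℤ)} (h : γ ∈ CongruenceSubgroup.Gamma0 N) :
    (N : ℤ) ∣ γ 1 0 := by
  rw [CongruenceSubgroup.Gamma0_mem] at h
  exact (ZMod.intCast_zmod_eq_zero_iff_dvd _ _).mp h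

lemma sum_shiftDiv_reindex {m : ℕ} [NeZero m] {γ : SL(2, ℤ)} (hγ : (m : ℤ) ∣ γ 1 0)
    (g : ℤ → ℂ) (h : ℤ → ℂ)
    (hgh : ∀ v w : ℤ, (m : ℤ) ∣ γ 0 1 + v * γ 1 1 - (γ 0 0 + v * γ 1 0) * w → g v = h w) :
    ∑ v : ZMod m, g v.val = ∑ v : ZMod m, h v.val := by
  have hc : ((γ 1 0 : ℤ) : ZMod m) = 0 := (ZMod.intCast_zmod_eq_zero_iff_dvd _ _).mpr hγ
  have hdet : ((γ 0 0 : ℤ) : ZMod m) * ((γ 1 1 : ℤ) : ZMod m) = 1 := by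
    have := congrArg (Int.cast : ℤ → ZMod m) (det_eq γ)
    push_cast at this
    rw [hc] at this
    simpa using this
  refine Fintype.sum_bijective
    -- As m divides c, d is inverse to a modulo m, so the integrality condition b + vd ≡ aw has the
    -- solution w = (b + vd)d, a bijection in v.
    (fun v : ZMod m => (((γ 0 1 : ℤ) : ZMod m) + v * ((γ 1 1 : ℤ) : ZMod m)) * ((γ 1 1 : ℤ) : ZMod m))
    ?_ _ _ fun v => hgh _ _ ?_
  · apply Finite.injective_iff_bijective.mp
    intro x y hxy
    simp only at hxy
    linear_combination ((γ 0 0 : ℤ) : ZMod m) ^ 2 * hxy -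
      (x - y) * (((γ 0 0 : ℤ) : ZMod m) * ((γ 1 1 : ℤ) : ZMod m) + 1) * hdet
  · rw [← ZMod.intCast_zmod_eq_zero_iff_dvd]
    push_cast
    rw [ZMod.natCast_zmod_val, ZMod.natCast_zmod_val, hc]
    linear_combination (-((γ 0 1 : ℤ) : ZMod m) - v * ((γ 1 1 : ℤ) : ZMod m)) * hdet

/-- `U_m` maps `S_{κ / 2}(Γ₀(576 m), ψ)` to `S_{κ / 2}(Γ₀(576 m), ψ χ_m)`. -/
theorem uFun_mem_cuspForms {m : ℕ} [NeZero m] {κ : ℤ} (hκ : Odd κ)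
    {ψ ψ' : DirichletCharacter ℂ (576 * m)}
    (hψ : ∀ d : ℤ, IsCoprime ((576 * m : ℕ) : ℤ) d →
      ψ' ((d : ℤ) : ZMod (576 * m)) = ψ ((d : ℤ) : ZMod (576 * m)) * (J(m | d.natAbs) : ℂ))
    {f : ℍ → ℂ} (hf : f ∈ cuspForms κ (576 * m) ψ) {a : PowerSeries ℤ}
    (ha : HasIntegralQExpansion f a) : uFun m f ∈ cuspForms κ (576 * m) ψ' := by
  obtain ⟨-, htr, hcusp⟩ := hf
  refine ⟨(ha.uFun m).mdifferentiable, fun γ hγ z => ?_, fun γ => ?_⟩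
  · have hdvd := dvd_of_mem_Gamma0 hγ
    have hcop : IsCoprime ((576 * m : ℕ) : ℤ) (γ 1 1) :=
      (isCoprime_bottom_row γ).of_isCoprime_of_dvd_left hdvd
    have hdvd' : (576 * m : ℤ) ∣ γ 1 0 := by exact_mod_cast hdvd
    -- The symbol is ±1 and κ is odd, so the theta factor to the power κ contributes exactly one
    -- factor χ_m(d).
    have hJ : (J(m | (γ 1 1).natAbs) : ℂ) ^ κ = J(m | (γ 1 1).natAbs) := by
      have hg : Int.gcd (m : ℤ) ((γ 1 1).natAbs : ℤ) = 1 := by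
        have h : IsCoprime (m : ℤ) (γ 1 1) :=
          hcop.of_isCoprime_of_dvd_left ⟨576, by push_cast; ring⟩
        rw [Int.isCoprime_iff_gcd_eq_one] at h
        rwa [Int.gcd_def, Int.natAbs_natCast (γ 1 1).natAbs, ← Int.gcd_def]
      rcases jacobiSym.eq_one_or_neg_one hg with h | h <;> rw [h]
      · simp
      · simpa using hκ.neg_one_zpow
    rw [uFun, uFun, sum_shiftDiv_reindex (dvd_trans ⟨576, mul_comm _ _⟩ hdvd')
      (fun v => f (shiftDiv m v (γ • z)))
      (fun w => ψ' ((γ 1 1 : ℤ) : ZMod (576 * m)) * thetaFactor γ z ^ κ * f (shiftDiv m w z)),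
      ← Finset.mul_sum]
    · ring
    · intro v w hvw
      obtain ⟨γ', h10, h11, hsm⟩ := exists_shiftDiv_smul hvw
      have hγ' : γ' ∈ CongruenceSubgroup.Gamma0 (576 * m) := by
        rw [CongruenceSubgroup.Gamma0_mem, h10, ZMod.intCast_zmod_eq_zero_iff_dvd]
        exact hdvd.mul_left _
      have hd : ((γ' 1 1 : ℤ) : ZMod (576 * m)) = ((γ 1 1 : ℤ) : ZMod (576 * m)) := by
        rw [h11, Int.cast_sub, Int.cast_mul, (ZMod.intCast_zmod_eq_zero_iff_dvd _ _).mpr hdvd]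
        simp
      rw [hsm, htr γ' hγ', hd, thetaFactor_shiftDiv hdvd' h10 h11, hψ _ hcop, mul_zpow, hJ]
      ring
  · have hm : (0 : ℝ) < (1 : ℤ) / ((m : ℤ) : ℝ) := by
      have : (0 : ℝ) < m := by exact_mod_cast NeZero.pos m
      push_cast
      positivity
    have hv := (vanishesAtCusps_iff κ f).mpr hcusp
    have hv' : ∀ v : ℤ, UpperHalfPlane.IsZeroAtImInfty fun z : ℍ =>
        sqrtDenom γ z ^ (-κ) * f (shiftDiv m v (γ • z)) := by
      intro v
      have := (vanishesAtCusps_iff κ _).mp (hv.comp_affine (B := v) one_pos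
        (by exact_mod_cast NeZero.pos m) hm) γ
      simpa only [shiftDiv_eq_affine m v hm] using this
    have hsum := (tendsto_finsetSum Finset.univ fun (v : ZMod m) _ => hv' v.val).const_mul
      (m : ℂ)⁻¹
    simp only [Finset.sum_const_zero, mul_zero] at hsum
    refine Tendsto.congr (fun z => ?_) hsum
    rw [uFun, ← Finset.mul_sum]
    ring

end PartitionModM

namespace PartitionModM

open NumberTheorySymbols Filter Topology ModularGroup

/-! ### The Hecke operator `T_m` in level one -/

/-- The modular transformation law of weight `k` and level one. -/
def IsLevelOne (k : ℕ) (f : ℍ → ℂ) : Prop :=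
  ∀ (γ : SL(2, ℤ)) (z : ℍ),
    f (γ • z) = (((γ 1 0 : ℤ) : ℂ) * z + ((γ 1 1 : ℤ) : ℂ)) ^ k * f z

lemma isLevelOne_of_generators {k : ℕ} {f : ℍ → ℂ} (hS : ∀ z : ℍ, f (S • z) = (z : ℂ) ^ k * f z)
    (hT : ∀ z : ℍ, f (T • z) = f z) : IsLevelOne k f := by
  intro γ z
  have h := congrFun (SlashInvariantForm.slash_action_generators_SL2Z (f := f) (k := k) ?_ ?_ γ) z
  · rw [ModularForm.SL_slash_apply, ModularGroup.denom_apply, zpow_neg, zpow_natCast] at h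
    rw [← h]
    field_simp [denom_ne_zero' γ z]
  · ext z
    rw [ModularForm.SL_slash_apply, ModularGroup.denom_apply, hS]
    simp [S]
    field_simp [z.ne_zero]
  · ext z
    rw [ModularForm.SL_slash_apply, ModularGroup.denom_apply, hT]
    simp [T]

/-- The Hecke operator `T_m` of weight `k` in level one. -/
def heckeFun (m : ℕ) [NeZero m] (k : ℕ) (f : ℍ → ℂ) (z : ℍ) : ℂ :=
  (m : ℂ) ^ (k - 1) * f (scale m (by exact_mod_cast NeZero.pos m) z) + uFun m f z

lemma coe_shiftDiv (m : ℕ) [NeZero m] (v : ℤ) (z : ℍ) : (shiftDiv m v z : ℂ) = (z + v) / m := rfl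

/-- Under S the terms with v ≠ 0 are permuted by v ↦ -1/v. The term v = 0 becomes a multiple of
f(mz); this defect is what the first term of T_m compensates. -/
lemma IsLevelOne.uFun_S {m : ℕ} [Fact m.Prime] {k : ℕ} {f : ℍ → ℂ} (hf : IsLevelOne k f)
    (hm : (0 : ℝ) < m) (z : ℍ) : uFun m f (S • z) = (z : ℂ) ^ k * uFun m f z +
      (m : ℂ)⁻¹ * ((m * z) ^ k * f (scale m hm z) - (z : ℂ) ^ k * f (shiftDiv m 0 z)) := by
  have hmC : (m : ℂ) ≠ 0 := by exact_mod_cast NeZero.ne m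
  have h0 : f (shiftDiv m ((0 : ZMod m).val : ℕ) (S • z)) = (m * z) ^ k * f (scale m hm z) := by
    have : shiftDiv m ((0 : ZMod m).val : ℕ) (S • z) = S • scale m hm z := by
      apply UpperHalfPlane.ext
      rw [coe_shiftDiv, coe_S_smul', coe_S_smul', coe_scale, ZMod.val_zero]
      push_cast
      field_simp
      ring
    rw [this, hf, coe_scale]
    simp [S]
  have h1 : ∑ v ∈ Finset.univ.erase (0 : ZMod m), f (shiftDiv m v.val (S • z)) =
      ∑ v ∈ Finset.univ.erase (0 : ZMod m), (z : ℂ) ^ k * f (shiftDiv m v.val z) := by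
    refine Finset.sum_nbij' (fun v => -v⁻¹) (fun v => -v⁻¹) ?_ ?_ ?_ ?_ ?_
    · intro v hv
      simpa using hv
    · intro v hv
      simpa using hv
    · intro v _
      rw [inv_neg, inv_inv, neg_neg]
    · intro v _
      rw [inv_neg, inv_inv, neg_neg]
    · intro v hv
      have hv0 : v ≠ 0 := by simpa using hv
      -- For γ = S the integrality condition reads vw ≡ -1 modulo m.
      obtain ⟨γ', h10, h11, hsm⟩ := exists_shiftDiv_smul (m := m) (γ := S) (v := v.val)
        (w := (-v⁻¹ : ZMod m).val) (by
          rw [← ZMod.intCast_zmod_eq_zero_iff_dvd]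
          simp [S, hv0])
      rw [hsm, hf, h10, h11, coe_shiftDiv]
      congr 2
      simp [S]
      field_simp
      ring
  rw [uFun, uFun, ← Finset.add_sum_erase _ _ (Finset.mem_univ (0 : ZMod m)), h0, h1,
    ← Finset.add_sum_erase _ _ (Finset.mem_univ (0 : ZMod m)), ZMod.val_zero, ← Finset.mul_sum]
  push_cast
  ring

lemma IsLevelOne.heckeFun {m : ℕ} [Fact m.Prime] {k : ℕ} (hk : 1 ≤ k) {f : ℍ → ℂ}
    (hf : IsLevelOne k f) : IsLevelOne k (heckeFun m k f) := by
  have hm : (0 : ℝ) < m := by exact_mod_cast NeZero.pos m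
  have hmC : (m : ℂ) ≠ 0 := by exact_mod_cast NeZero.ne m
  apply isLevelOne_of_generators
  · intro z
    have h0 : scale m hm (S • z) = S • shiftDiv m 0 z := by
      apply UpperHalfPlane.ext
      rw [coe_scale, coe_S_smul', coe_S_smul', coe_shiftDiv, Int.cast_zero, add_zero,
        Complex.ofReal_natCast, inv_div, mul_neg, div_eq_mul_inv]
    rw [PartitionModM.heckeFun, PartitionModM.heckeFun, hf.uFun_S hm, h0, hf, coe_shiftDiv]
    obtain ⟨j, rfl⟩ := Nat.exists_eq_add_of_le' hk
    have hden : ((S 1 0 : ℤ) : ℂ) * ((z + ((0 : ℤ) : ℂ)) / m) + ((S 1 1 : ℤ) : ℂ) =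
        (z : ℂ) / m := by simp [S]
    rw [hden, Nat.add_sub_cancel, div_pow, mul_pow]
    field_simp
    ring
  · intro z
    have h0 : scale m hm (T • z) = T ^ (m : ℤ) • scale m hm z := by
      apply UpperHalfPlane.ext
      have h1 := coe_T_zpow_smul' 1 z
      rw [zpow_one] at h1
      rw [coe_scale, h1, coe_T_zpow_smul', coe_scale]
      push_cast
      ring
    rw [PartitionModM.heckeFun, PartitionModM.heckeFun, h0, hf]
    congr 1
    · simp only [coe_T_zpow]
      simp
    · rw [uFun, uFun, sum_shiftDiv_reindex (γ := T) (by simp [T])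
        (fun v => f (shiftDiv m v (T • z))) (fun v => f (shiftDiv m v z))]
      intro v w hvw
      obtain ⟨γ', h10, h11, hsm⟩ := exists_shiftDiv_smul hvw
      rw [hsm, hf, h10, h11]
      simp [T]

/-! ### The power `Δ ^ N` -/

/-- The form `Δ ^ N = η ^ (24 N)`. -/
def deltaPow (N : ℕ) (z : ℍ) : ℂ := ModularForm.eta z ^ (24 * N)

lemma eta_smul_pow (γ : SL(2, ℤ)) (z : ℍ) : ModularForm.eta (γ • z : ℍ) ^ 24 =
    (((γ 1 0 : ℤ) : ℂ) * z + ((γ 1 1 : ℤ) : ℂ)) ^ 12 * ModularForm.eta z ^ 24 := by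
  have h := congrFun (SlashInvariantForm.slash_action_generators_SL2Z
    ModularForm.discriminant_S_invariant ModularForm.discriminant_T_invariant γ) z
  rw [ModularForm.SL_slash_apply, ModularGroup.denom_apply, ModularForm.discriminant,
    ModularForm.discriminant] at h
  rw [← h]
  have := denom_ne_zero' γ z
  rw [zpow_neg, mul_comm, mul_assoc, ← zpow_natCast _ 12, Nat.cast_ofNat,
    inv_mul_cancel₀ (zpow_ne_zero _ this), mul_one]

lemma isLevelOne_deltaPow (N : ℕ) : IsLevelOne (12 * N) (deltaPow N) := by
  intro γ z
  rw [deltaPow, deltaPow, pow_mul, eta_smul_pow, mul_pow, ← pow_mul, ← pow_mul]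

lemma hasIntegralQExpansion_deltaPow (N : ℕ) :
    HasIntegralQExpansion (deltaPow N) (deltaPowSeries ℤ N) := by
  have h := (convergesTo_X.pow N).mul (convergesTo_pentagonalSeries.pow (24 * N))
  have he : toComplex (deltaPowSeries ℤ N) =
      PowerSeries.X ^ N * PowerSeries.pentagonalSeries ℂ ^ (24 * N) := by
    rw [deltaPowSeries, toComplex, map_mul, map_pow, map_pow, PowerSeries.map_X, map_pentagonalSeries]
  rw [← he] at h
  have h' := h.hasIntegralQExpansion
  refine (congrArg (HasIntegralQExpansion · _) (funext fun z => ?_)).mpr h'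
  rw [deltaPow, eta_eq, mul_pow, Pi.mul_apply, Pi.pow_apply, Pi.pow_apply, id, pow_mul,
    ← Complex.exp_nat_mul, qOf]
  congr 3
  push_cast
  ring

lemma HasIntegralQExpansion.mul {f g : ℍ → ℂ} {a b : PowerSeries ℤ}
    (hf : HasIntegralQExpansion f a) (hg : HasIntegralQExpansion g b) :
    HasIntegralQExpansion (fun z => f z * g z) (a * b) := by
  obtain ⟨φ, hφ, hfφ⟩ := hf.exists_convergesTo
  obtain ⟨ψ, hψ, hgψ⟩ := hg.exists_convergesTo
  have h := hφ.mul hψ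
  rw [← map_mul] at h
  refine (congrArg (HasIntegralQExpansion · _) (funext fun z => ?_)).mpr h.hasIntegralQExpansion
  rw [hfφ, hgψ, Pi.mul_apply]

lemma hasIntegralQExpansion_heckeFun (m : ℕ) [NeZero m] (N : ℕ) :
    HasIntegralQExpansion (heckeFun m (12 * N) (deltaPow N)) (heckeSeries m (NeZero.ne m) N) := by
  have h := hasIntegralQExpansion_deltaPow N
  have h' := ((h.expand (NeZero.ne m) (by exact_mod_cast NeZero.pos m)).const_mul
    ((m : ℤ) ^ (12 * N - 1))).add (h.uFun m)
  refine (congrArg (HasIntegralQExpansion · _) (funext fun z => ?_)).mpr h'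
  rw [heckeFun]
  push_cast
  rfl

/-! ### The form attached to `F(m, 1; z)` -/

/-- The quotient `(Δ ^ N | T_m) / η ^ m`. -/
def quotFun (m : ℕ) [NeZero m] (N : ℕ) (z : ℍ) : ℂ :=
  heckeFun m (12 * N) (deltaPow N) z / ModularForm.eta z ^ m

/-- The form `(Δ ^ N | T_m)(24 z) / η(24 z) ^ m`. -/
def formFun (m : ℕ) [NeZero m] (N : ℕ) (z : ℍ) : ℂ := quotFun m N (scale 24 (by norm_num) z)

/-- η(24z) is q·E(q^24) with no fractional exponent, so dividing by its m-th power means multiplying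
by P(q^24)^m and shifting by m, which the vanishing up to order m permits. -/
lemma hasIntegralQExpansion_formFun {m N : ℕ} [NeZero m] (h1 : 1 < m)
    (hN : m ^ 2 = 24 * N + 1) :
    HasIntegralQExpansion (formFun m N) (formSeries m (NeZero.ne m) N) := by
  have hP := convergesTo_partitionSeries.pow m
  rw [← map_partitionSeries (Int.castRingHom ℂ), ← map_pow] at hP
  have h := ((((hasIntegralQExpansion_heckeFun m N).mul hP.hasIntegralQExpansion).expand
    (m := 24) (by norm_num) (by norm_num))).shift (m := m) fun n hn =>
      coeff_expand_quotSeries_of_le (NeZero.ne m) h1 hN hn.le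
  refine (congrArg (HasIntegralQExpansion · _) (funext fun z => ?_)).mpr h
  rw [formFun, quotFun, eta_eq, coe_scale]
  have hq : Complex.exp (2 * Real.pi * Complex.I * (((24 : ℝ) : ℂ) * z) / 24) = qOf z := by
    rw [qOf]
    congr 1
    push_cast
    ring
  rw [hq, Pi.pow_apply, Pi.inv_apply, mul_pow, inv_pow, coe_scale, div_eq_mul_inv, mul_inv,
    div_eq_mul_inv]
  push_cast
  ring

lemma coeff_zero_formSeries {m N : ℕ} (hm : m ≠ 0) (h1 : 1 < m) (hN : m ^ 2 = 24 * N + 1) :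
    PowerSeries.coeff 0 (formSeries m hm N) = 0 := by
  rw [formSeries, PowerSeries.coeff_mk, zero_add]
  exact coeff_expand_quotSeries_of_le hm h1 hN le_rfl

/-- The quotient itself has fractional exponents in q, so the limit is read off from its rescaling
by 24. -/
lemma quotFun_isZeroAtImInfty {m N : ℕ} [NeZero m] (h1 : 1 < m) (hN : m ^ 2 = 24 * N + 1) :
    UpperHalfPlane.IsZeroAtImInfty (quotFun m N) := by
  have h := (hasIntegralQExpansion_formFun h1 hN).isZeroAtImInfty
    (coeff_zero_formSeries (NeZero.ne m) h1 hN)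
  refine (Tendsto.comp h (tendsto_affine (1 / 24) (by norm_num) 0)).congr fun z => ?_
  rw [Function.comp_apply, formFun]
  congr 1
  apply UpperHalfPlane.ext
  rw [coe_scale, coe_affine]
  push_cast
  ring

lemma norm_eta_smul (γ : SL(2, ℤ)) (z : ℍ) :
    ‖ModularForm.eta (γ • z : ℍ)‖ = ‖sqrtDenom γ z‖ * ‖ModularForm.eta z‖ := by
  have h := congrArg norm (eta_smul_pow γ z)
  rw [← sqrtDenom_sq, ← pow_mul, norm_pow, norm_mul, norm_pow, norm_pow, ← mul_pow] at h
  exact (pow_left_inj₀ (norm_nonneg _) (by positivity) (by norm_num)).mp h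

/-- The numerator has level one and |η| is modular for all of SL₂(ℤ), so the normalised absolute
value at γz equals that at z and only i∞ matters. The weights match since m² - m - 1 = 24N - m. -/
lemma vanishesAtCusps_quotFun {m N : ℕ} [Fact m.Prime] (hN : m ^ 2 = 24 * N + 1) :
    VanishesAtCusps (((m : ℤ) ^ 2 - m - 1 : ℤ) / 4) (quotFun m N) := by
  have h1 : 1 < m := (Fact.out : m.Prime).one_lt
  have hN0 : 1 ≤ 12 * N := by nlinarith
  rw [vanishesAtCusps_iff]
  intro γ
  refine (tendsto_zero_iff_norm_tendsto_zero).mpr ?_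
  refine (tendsto_zero_iff_norm_tendsto_zero.mp (quotFun_isZeroAtImInfty h1 hN)).congr fun z => ?_
  have hs := norm_pos_iff.mpr (sqrtDenom_ne_zero γ z)
  have he : 0 < ‖ModularForm.eta z‖ := norm_pos_iff.mpr (ModularForm.eta_ne_zero z.2)
  have hκ : (m : ℤ) ^ 2 - m - 1 = 24 * N - m := by
    have : (m : ℤ) ^ 2 = 24 * N + 1 := by exact_mod_cast hN
    rw [this]; ring
  rw [norm_mul, norm_zpow, quotFun, quotFun, norm_div, norm_div,
    (isLevelOne_deltaPow N).heckeFun hN0 γ z, norm_mul, norm_pow, norm_pow, norm_pow,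
    norm_eta_smul, ← sqrtDenom_sq, norm_pow, hκ, neg_sub, zpow_sub₀ hs.ne', mul_pow]
  have hp : ‖sqrtDenom γ z‖ ^ (24 * (N : ℤ)) = (‖sqrtDenom γ z‖ ^ 2) ^ (12 * N) := by
    rw [← pow_mul, ← zpow_natCast]
    congr 1
    push_cast
    ring
  rw [hp, zpow_natCast]
  field_simp

lemma thetaFactor_pow_four (γ : SL(2, ℤ)) (z : ℍ) : thetaFactor γ z ^ 4 =
    (((γ 1 0 : ℤ) : ℂ) * z + ((γ 1 1 : ℤ) : ℂ)) ^ 2 := by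
  have hJ : quadSymbol (γ 1 0) (γ 1 1) ^ 2 = 1 := by
    have hJ' : J(γ 1 0 | (γ 1 1).natAbs) ^ 2 = 1 := by
      rw [← jacobiSym.pow_left]
      exact jacobiSym_sq_eq_one (isCoprime_bottom_row γ)
    rw [quadSymbol]
    split_ifs
    · rw [neg_sq, hJ']
    · exact hJ'
  have hJC : ((quadSymbol (γ 1 0) (γ 1 1) : ℤ) : ℂ) ^ 2 = 1 := by exact_mod_cast hJ
  have he : (epsilon (γ 1 1))⁻¹ ^ 4 = 1 := by
    rw [epsilon]
    split_ifs
    · simp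
    · rw [inv_pow, Complex.I_pow_four, inv_one]
  calc thetaFactor γ z ^ 4 = (((quadSymbol (γ 1 0) (γ 1 1) : ℤ) : ℂ) ^ 2) ^ 2 *
        (epsilon (γ 1 1))⁻¹ ^ 4 * (sqrtDenom γ z ^ 2) ^ 2 := by rw [thetaFactor]; ring
    _ = _ := by rw [hJC, he, sqrtDenom_sq]; ring

lemma chi12_sq {d : ℤ} (h : IsCoprime (6 : ℤ) d) : chi12 ((d : ℤ) : ZMod 12) ^ 2 = 1 := by
  rw [chi12_intCast_eq h, ← jacobiSym.pow_left]
  exact jacobiSym_sq_eq_one (h.of_isCoprime_of_dvd_left (by norm_num))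

/-- The numerator has automorphy factor (cz + d)^(12N) = j^(24N), as j⁴ = (cz + d)². Dividing by
(χj)^m leaves χ·j^(24N - m), because m is odd and χ(d)² = 1. Cuspidality passes from the level one
quotient through z ↦ 24z. -/
lemma formFun_mem_cuspForms {m N : ℕ} [Fact m.Prime] (hN : m ^ 2 = 24 * N + 1) :
    formFun m N ∈ cuspForms ((m : ℤ) ^ 2 - m - 1) (576 * m) (nebentypus m 1) := by
  have h1 : 1 < m := (Fact.out : m.Prime).one_lt
  have hN0 : 1 ≤ 12 * N := by nlinarith
  refine ⟨(hasIntegralQExpansion_formFun h1 hN).mdifferentiable, fun γ hγ z => ?_, ?_⟩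
  · have hdvd := dvd_of_mem_Gamma0 hγ
    have hcop : IsCoprime ((576 * m : ℕ) : ℤ) (γ 1 1) :=
      (isCoprime_bottom_row γ).of_isCoprime_of_dvd_left hdvd
    have h576 : (576 : ℤ) ∣ γ 1 0 := dvd_trans ⟨m, by push_cast; ring⟩ hdvd
    have h6 := isCoprime_six_of_mem_Gamma0 h576
    obtain ⟨δ, -, d10, d11, hsm⟩ := exists_scale_smul (γ := γ) (dvd_trans (by norm_num) h576)
    have hH := (isLevelOne_deltaPow N).heckeFun (m := m) hN0 δ (scale 24 (by norm_num) z)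
    rw [← hsm] at hH
    have hden : ((δ 1 0 : ℤ) : ℂ) * (scale 24 (by norm_num) z : ℍ) + ((δ 1 1 : ℤ) : ℂ) =
        ((γ 1 0 : ℤ) : ℂ) * z + ((γ 1 1 : ℤ) : ℂ) := by
      rw [coe_scale, d10, d11]
      push_cast
      ring
    have hη := eta_smul h576 z
    have hχ : (chi12 ((γ 1 1 : ℤ) : ZMod 12) : ℂ) ^ 2 = 1 := by exact_mod_cast chi12_sq h6
    have hχ0 : (chi12 ((γ 1 1 : ℤ) : ZMod 12) : ℂ) ≠ 0 := by
      intro h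
      rw [h] at hχ
      norm_num at hχ
    have hθ0 : thetaFactor γ z ≠ 0 := by
      intro h
      have := thetaFactor_pow_four γ z
      rw [h, zero_pow (by norm_num)] at this
      exact denom_ne_zero' γ z (pow_eq_zero_iff (by norm_num) |>.mp this.symm)
    have hκ : (m : ℤ) ^ 2 - m - 1 = (24 * N : ℕ) - (m : ℕ) := by
      have : (m : ℤ) ^ 2 = 24 * N + 1 := by exact_mod_cast hN
      rw [this]; push_cast; ring
    have hodd : Odd m := by
      rcases Nat.even_or_odd m with ⟨t, ht⟩ | h
      · exfalso
        have : 2 * (2 * t ^ 2) = 24 * N + 1 := by rw [← hN, ht]; ring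
        omega
      · exact h
    obtain ⟨j, hj⟩ := hodd
    have hχm : (chi12 ((γ 1 1 : ℤ) : ZMod 12) : ℂ) ^ m = chi12 ((γ 1 1 : ℤ) : ZMod 12) := by
      rw [hj, pow_succ, pow_mul, hχ, one_pow, one_mul]
    rw [formFun, formFun, quotFun, quotFun, hH, hden, coe_scale, coe_scale, Complex.ofReal_ofNat,
      hη, nebentypus_one hcop, hκ, zpow_sub₀ hθ0, zpow_natCast, zpow_natCast, mul_pow, mul_pow, hχm,
      show 24 * N = 4 * (6 * N) by ring, pow_mul (thetaFactor γ z), thetaFactor_pow_four, ← pow_mul,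
      show 2 * (6 * N) = 12 * N by ring]
    have hη0 : ModularForm.eta (24 * z) ≠ 0 := by
      have := ModularForm.eta_ne_zero (scale 24 (by norm_num) z).2
      simpa [scale] using this
    generalize ((γ 1 0 : ℤ) : ℂ) * z + ((γ 1 1 : ℤ) : ℂ) = X
    generalize (chi12 ((γ 1 1 : ℤ) : ZMod 12) : ℂ) = x at hχ hχ0
    field_simp
    rw [hχ, mul_one]
  · have h24 : (0 : ℝ) < (24 : ℤ) / (1 : ℤ) := by norm_num
    rw [← vanishesAtCusps_iff]
    have h := (vanishesAtCusps_quotFun hN).comp_affine (A := 24) (B := 0) (D := 1) (by norm_num)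
      (by norm_num) h24
    have he : (fun z => quotFun m N (affine ((24 : ℤ) / (1 : ℤ)) h24 ((0 : ℤ) / (1 : ℤ)) z)) =
        formFun m N := by
      ext z
      rw [formFun]
      congr 1
      apply UpperHalfPlane.ext
      rw [coe_affine, coe_scale]
      push_cast
      ring
    rwa [he] at h

/-! ### The choice of N and the induction on k. -/

lemma exists_sq_eq {m : ℕ} [Fact m.Prime] (hm : 5 ≤ m) : ∃ N, 0 < N ∧ m ^ 2 = 24 * N + 1 := by
  have hp : m.Prime := Fact.out
  have h2 : m % 2 ≠ 0 := fun h => by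
    have := (Nat.prime_dvd_prime_iff_eq Nat.prime_two hp).mp (Nat.dvd_of_mod_eq_zero h)
    omega
  have h3 : m % 3 ≠ 0 := fun h => by
    have := (Nat.prime_dvd_prime_iff_eq Nat.prime_three hp).mp (Nat.dvd_of_mod_eq_zero h)
    omega
  have h24 : m ^ 2 % 24 = 1 := by
    have hr : m % 24 = 1 ∨ m % 24 = 5 ∨ m % 24 = 7 ∨ m % 24 = 11 ∨ m % 24 = 13 ∨ m % 24 = 17 ∨
        m % 24 = 19 ∨ m % 24 = 23 := by omega
    rw [Nat.pow_mod]
    rcases hr with h | h | h | h | h | h | h | h <;> rw [h]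
  exact ⟨m ^ 2 / 24, Nat.div_pos (by nlinarith) (by norm_num), by omega⟩

end PartitionModM

end

theorem theorem8 (m : ℕ) [Fact m.Prime] (hm : 5 ≤ m) (k : ℕ) (hk : 1 ≤ k) :
    PartitionModM.F m k ∈
      PartitionModM.cuspFormsMod ((m : ℤ) ^ 2 - (m : ℤ) - 1) (576 * m)
        (PartitionModM.nebentypus m k) m := by
  obtain ⟨N, hN0, hN⟩ := PartitionModM.exists_sq_eq hm
  induction k, hk using Nat.le_induction with
  | base =>
    exact ⟨_, PartitionModM.formFun_mem_cuspForms hN, _,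
      PartitionModM.hasIntegralQExpansion_formFun (by omega) hN,
      PartitionModM.map_formSeries (NeZero.ne m) hN hN0⟩
  | succ k hk ih =>
    obtain ⟨f, hf, a, ha, hF⟩ := ih
    -- The product m(m - 1) is even.
    have hκ : Odd ((m : ℤ) ^ 2 - m - 1) := by
      obtain ⟨t, ht⟩ := Int.even_mul_pred_self (m : ℤ)
      exact ⟨t - 1, by linear_combination ht⟩
    refine ⟨_, PartitionModM.uFun_mem_cuspForms hκ (fun d hd => ?_) hf ha, _, ha.uFun m, ?_⟩
    · exact PartitionModM.nebentypus_succ (by omega) hk hd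
    · rw [PartitionModM.map_uSeries, hF, PartitionModM.F_succ]
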